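/- **Setting.** Let $k_0\ge 2$, $d_1,\dots,d_{k_0}\ge 1$, $n_0=0$, $n_i=d_1+\dots+d_i$ and $d=n_{k_0}$. For a vector $x$, let $\mathbf x_{n_i}$ be its first $n_i$ coordinates and $\mathbf x_{[n_{i-1}+1,n_i]}$ the coordinates $n_{i-1}+1,\dots,n_i$. Let $\mathcal P(S)$ be the set of Borel probability measures on $S$. Let $\mu,\nu\in\mathcal P(\mathbb R^d)$, with marginals $\mu_i,\nu_i$ on the first $n_i$ coordinates, and let $\mu_i(d\mathbf x_{[n_{i-1}+1,n_i]}\mid \mathbf x_{n_{i-1}})$ be the regular conditional probability. *Assumptions.* - (A0,i) $p:\mathbb R^d\times\mathbb R^d\to(0,\infty)$ is continuous and $\int p(x,y)\,dy=1$ for all $x$. For $1\le i<k_0$, $p_i(\mathbf x_{n_i},\mathbf y_{n_i}):=\int_{\mathbb R^{d-n_i}}p(x,(\mathbf y_{n_i},w))\,dw$ does not depend on the coordinates of $x$ after the $n_i$-th, and is finite and continuous. Put $p_{k_0}:=p$. - (A0,iii) For $2\le i\le k_0$ there is $\psi_i\in C(\mathbb R^{d_i})$ such that $z\mapsto\log p_i(\mathbf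 x_{n_i},(\mathbf y_{n_{i-1}},z))+\psi_i(z)$ is convex for all $\mathbf x_{n_i},\mathbf y_{n_{i-1}}$. - (A1,i) $\nu$ has a density $f_\nu$. Put $f_{\nu_i}(\mathbf y_{n_i}):=\int f_\nu(\mathbf y_{n_i},w)\,dw$ for $i<k_0$ and $f_{\nu_{k_0}}:=f_\nu$. *Notation.* Let $2\le i\le k_0$. Put $$p_i(x,z\mid\mathbf y_{n_{i-1}}):=\frac{p_i(x,(\mathbf y_{n_{i-1}},z))}{\int p_i(x,(\mathbf y_{n_{i-1}},z'))\,dz'},\qquad f_{\nu_i}(z\mid\mathbf y_{n_{i-1}}):=\frac{f_{\nu_i}(\mathbf y_{n_{i-1}},z)}{f_{\nu_{i-1}}(\mathbf y_{n_{i-1}})} .$$ Let $h_j:\mathbb R^{n_j}\to[0,\infty)$, $1\le j\le i-1$, be given functions, $h_j(\mathbf y_{n_{j-1}},\cdot)$ being measurable for every $\mathbf y_{n_{j-1}}$ (for instance solutions of the Schrödinger equations of the previous levels). Put $h_j(0,\mathbf x_{n_j},\mathbf y_{n_{j-1}}):=\int h_j(\mathbf y_{n_{j-1}},z)\,p_j(\mathbf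 x_{n_j},(\mathbf y_{n_{j-1}},z))\,dz$, $$\pi_{\mu_{i-1},\nu_{i-1}}(\mathbf y_{n_{i-1}},d\mathbf x_{n_{i-1}}):=\frac1{f_{\nu_{i-1}}(\mathbf y_{n_{i-1}})}\prod_{j=1}^{i-1}\frac{h_j(\mathbf y_{n_j})\,p_j(\mathbf x_{n_j},\mathbf y_{n_j})}{h_j(0,\mathbf x_{n_j},\mathbf y_{n_{j-1}})}\,\mu_{i-1}(d\mathbf x_{n_{i-1}}),$$ $$Q_{\mathbf y_{n_{i-1}}}(d\mathbf x_{n_i}):=\pi_{\mu_{i-1},\nu_{i-1}}(\mathbf y_{n_{i-1}},d\mathbf x_{n_{i-1}})\,\mu_i(d\mathbf x_{[n_{i-1}+1,n_i]}\mid\mathbf x_{n_{i-1}}).$$ **Proposition 2.1.** Assume (A0,i), (A0,iii) and (A1,i). Let $2\le i\le k_0$, and let $\mathbf y_{n_{i-1}}$ be such that $f_{\nu_{i-1}}(\mathbf y_{n_{i-1}})>0$ and $\pi_{\mu_{i-1},\nu_{i-1}}(\mathbf y_{n_{i-1}},\cdot)$ is a probability measure. Write $Q=Q_{\mathbf y_{n_{i-1}}}$.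 1. The equation between measures on $\mathbb R^{d_i}$ $$f_{\nu_i}(z\mid\mathbf y_{n_{i-1}})\,dz=h_i(\mathbf y_{n_{i-1}},z)\,dz\int_{\mathbb R^{n_i}}\frac{p_i(x,z\mid\mathbf y_{n_{i-1}})}{\int_{\mathbb R^{d_i}}h_i(\mathbf y_{n_{i-1}},z')\,p_i(x,z'\mid\mathbf y_{n_{i-1}})\,dz'}\,Q(dx)$$ has a measurable solution $h_i(\mathbf y_{n_{i-1}},\cdot):\mathbb R^{d_i}\to[0,\infty)$. It is unique up to a multiplicative function of $\mathbf y_{n_{i-1}}$: the measurable solutions at $\mathbf y_{n_{i-1}}$ are exactly the measurable functions that agree $dz$-a.e. with a positive constant multiple of one of them. 2. For every such solution, with $h_i(0,x,\mathbf y_{n_{i-1}})$ defined as above for $j=i$, the measure $$\pi_{\mu_i,\nu_i}(\mathbf y_{n_{i-1}},dx\,dz):=\frac{h_i(\mathbf y_{n_{i-1}},z)\,p_i(x,(\mathbf y_{n_{i-1}},z))}{h_i(0,x,\mathbf y_{n_{i-1}})}\,Q(dx)\,dz$$ is a probability measure on $\mathbb R^{n_i}\times\mathbb R^{d_i}$ with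 marginals $Q$ and $f_{\nu_i}(z\mid\mathbf y_{n_{i-1}})\,dz$. 3. Suppose in addition that $h_1,\dots,h_{i-1}$ are measurable. Define inductively the measures $$\pi_{\mu_1,\nu_1}(d\mathbf x_{n_1}d\mathbf y_{n_1}):=\frac{h_1(\mathbf y_{n_1})}{\int h_1(z)p_1(\mathbf x_{n_1},z)\,dz}\,\mu_1(d\mathbf x_{n_1})\,p_1(\mathbf x_{n_1},\mathbf y_{n_1})\,d\mathbf y_{n_1},$$ $$\pi_{\mu_{j-1},\nu_{j-1}}\otimes\mu_{j|j-1}(d\mathbf x_{n_j}d\mathbf y_{n_{j-1}}):=\pi_{\mu_{j-1},\nu_{j-1}}(d\mathbf x_{n_{j-1}}d\mathbf y_{n_{j-1}})\,\mu_j(d\mathbf x_{[n_{j-1}+1,n_j]}\mid\mathbf x_{n_{j-1}}),$$ $$\pi_{0,j}(d\mathbf x_{n_j}d\mathbf y_{n_j}):=\pi_{\mu_{j-1},\nu_{j-1}}\otimes\mu_{j|j-1}(d\mathbf x_{n_j}d\mathbf y_{n_{j-1}})\,p_j(\mathbf x_{n_j},\mathbf y_{[n_{j-1}+1,n_j]}\mid\mathbf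 y_{n_{j-1}})\,d\mathbf y_{[n_{j-1}+1,n_j]},$$ $$\pi_{\mu_j,\nu_j}(d\mathbf x_{n_j}d\mathbf y_{n_j}):=\frac{h_j(\mathbf y_{n_j})}{\int h_j(\mathbf y_{n_{j-1}},z)p_j(\mathbf x_{n_j},z\mid\mathbf y_{n_{j-1}})\,dz}\,\pi_{0,j}(d\mathbf x_{n_j}d\mathbf y_{n_j}).$$ Fix versions of the regular conditional probabilities $\pi_{\mu_{i-1},\nu_{i-1}}\otimes\mu_{i|i-1}(d\mathbf x_{n_i}\mid\mathbf y_{n_{i-1}})$ and $\pi_{0,i}(d\mathbf x_{n_i}d\mathbf y_{[n_{i-1}+1,n_i]}\mid\mathbf y_{n_{i-1}})$, and suppose that at the given $\mathbf y_{n_{i-1}}$ $$\pi_{0,i}(dx\,dz\mid\mathbf y_{n_{i-1}})=\pi_{\mu_{i-1},\nu_{i-1}}\otimes\mu_{i|i-1}(dx\mid\mathbf y_{n_{i-1}})\,p_i(x,z\mid\mathbf y_{n_{i-1}})\,dz,\qquad \pi_{\mu_{i-1},\nu_{i-1}}\otimes\mu_{i|i-1}(dx\mid\mathbf y_{n_{i-1}})=Q(dx).$$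 Then, with $H$ the relative entropy, $\pi_{\mu_i,\nu_i}(\mathbf y_{n_{i-1}},\cdot)$ is the unique minimizer of $$\inf\bigl\{H\bigl(\pi\,\|\,\pi_{0,i}(\cdot\mid\mathbf y_{n_{i-1}})\bigr):\ \pi\in\mathcal P(\mathbb R^{n_i}\times\mathbb R^{d_i})\text{ with marginals }Q\text{ and }f_{\nu_i}(z\mid\mathbf y_{n_{i-1}})\,dz\bigr\},$$ provided that this infimum is finite. In particular, this holds for $f_{\nu_{i-1}}(\mathbf y_{n_{i-1}})\,d\mathbf y_{n_{i-1}}$-a.e. $\mathbf y_{n_{i-1}}$ if these conditions hold a.e. -/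

import Mathlib

open MeasureTheory ProbabilityTheory InformationTheory
open scoped ENNReal NNReal

namespace CondSchrodinger

noncomputable section

/-! ### Block coordinates

`d j` (for `1 ≤ j ≤ k`) are the block sizes, `nn d i = d 1 + ⋯ + d i`, and the ambient dimension is
`nn d k`. -/

/-- The partial sums `n_i = d_1 + ⋯ + d_i`. -/
def nn (d : ℕ → ℕ) : ℕ → ℕ
  | 0 => 0
  | i + 1 => nn d i + d (i + 1)

theorem nn_mono (d : ℕ → ℕ) {i j : ℕ} (h : i ≤ j) : nn d i ≤ nn d j :=
  monotone_nat_of_le_succ (f := nn d) (fun _ => Nat.le_add_right _ _) h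

/-- `ℝ^{n_i}`. -/
abbrev E (d : ℕ → ℕ) (i : ℕ) : Type := Fin (nn d i) → ℝ

/-- `ℝ^{d_i}`. -/
abbrev B (d : ℕ → ℕ) (i : ℕ) : Type := Fin (d i) → ℝ

/-- The coordinates `ℝ^{D - n_i}` that follow the first `n_i` ones in `ℝ^D`, `D = n_k`. -/
abbrev Tail (d : ℕ → ℕ) (k i : ℕ) : Type := Fin (nn d k - nn d i) → ℝ

/-- `(y, z) ∈ ℝ^{n_{i+1}}` for `y ∈ ℝ^{n_i}`, `z ∈ ℝ^{d_{i+1}}`. -/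
def join {d : ℕ → ℕ} {i : ℕ} (y : E d i) (z : B d (i + 1)) : E d (i + 1) :=
  Fin.append y z

/-- `(y, w) ∈ ℝ^{n_k}` for `y ∈ ℝ^{n_i}`, `w ∈ ℝ^{n_k - n_i}`. -/
def glue {d : ℕ → ℕ} {k i : ℕ} (y : E d i) (w : Tail d k i) : E d k := fun j =>
  if hj : (j : ℕ) < nn d i then y ⟨j, hj⟩ else w ⟨j - nn d i, by have := j.2; omega⟩

/-- The first `n_i` coordinates of a point of `ℝ^{n_j}`, `i ≤ j`. -/
def trunc {d : ℕ → ℕ} {i j : ℕ} (h : i ≤ j) (x : E d j) : E d i :=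
  fun l => x (Fin.castLE (nn_mono d h) l)

/-- The coordinates `n_i + 1, …, n_{i+1}` of a point of `ℝ^{n_{i+1}}`. -/
def lastBlock {d : ℕ → ℕ} {i : ℕ} (x : E d (i + 1)) : B d (i + 1) :=
  fun l => x (Fin.natAdd (nn d i) l)

/-! ### Marginal and conditional densities -/

/-- `p_i(x, y) = ∫ p((x, x'), (y, w)) dw`, evaluated at `x' = 0`; `DensityAssumption` below makes it
independent of `x'`, finite and continuous. For `i = k` no variable is integrated, so `p_k = p`. -/
def pMarg (d : ℕ → ℕ) (k : ℕ) (p : E d k → E d k → ℝ) (i : ℕ) (x y : E d i) : ℝ≥0∞ :=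
  ∫⁻ w : Tail d k i, ENNReal.ofReal (p (glue x 0) (glue y w))

/-- `p_{i+1}(x, z | y) = p_{i+1}(x, (y, z)) / ∫ p_{i+1}(x, (y, z')) dz'`. -/
def pCond (d : ℕ → ℕ) (k : ℕ) (p : E d k → E d k → ℝ) (i : ℕ)
    (x : E d (i + 1)) (z : B d (i + 1)) (y : E d i) : ℝ≥0∞ :=
  pMarg d k p (i + 1) x (join y z) / ∫⁻ z' : B d (i + 1), pMarg d k p (i + 1) x (join y z')

/-- `p` is a positive continuous family of probability densities on `ℝ^{n_k}`, and for `1 ≤ i < k`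
the marginal `p_i` does not depend on the coordinates of `x` after the `n_i`-th one, and is finite
and continuous. -/
structure DensityAssumption (d : ℕ → ℕ) (k : ℕ) (p : E d k → E d k → ℝ) : Prop where
  cont : Continuous (Function.uncurry p)
  pos : ∀ x y, 0 < p x y
  prob : ∀ x, ∫⁻ y, ENNReal.ofReal (p x y) = 1
  indep : ∀ i, 1 ≤ i → ∀ hi : i < k, ∀ x x' : E d k, trunc hi.le x = trunc hi.le x' →
    ∀ y : E d i, ∫⁻ w : Tail d k i, ENNReal.ofReal (p x (glue y w)) =
      ∫⁻ w : Tail d k i, ENNReal.ofReal (p x' (glue y w))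
  marg_finite : ∀ i, 1 ≤ i → i < k → ∀ x y, pMarg d k p i x y ≠ ∞
  marg_cont : ∀ i, 1 ≤ i → i < k → Continuous (Function.uncurry (pMarg d k p i))

/-- For `2 ≤ i + 1 ≤ k` there is a continuous `ψ` on `ℝ^{d_{i+1}}` such that
`z ↦ log p_{i+1}(x, (y, z)) + ψ(z)` is convex for all `x`, `y`. -/
def ConvexityAssumption (d : ℕ → ℕ) (k : ℕ) (p : E d k → E d k → ℝ) : Prop :=
  ∀ i, 1 ≤ i → i + 1 ≤ k → ∃ ψ : B d (i + 1) → ℝ, Continuous ψ ∧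
    ∀ (x : E d (i + 1)) (y : E d i), ConvexOn ℝ Set.univ
      (fun z => Real.log (pMarg d k p (i + 1) x (join y z)).toReal + ψ z)

/-- `f` is a (Borel) density of `ν`. -/
def HasDensity {d : ℕ → ℕ} {k : ℕ} (ν : Measure (E d k)) (f : E d k → ℝ≥0) : Prop :=
  Measurable f ∧ ν = volume.withDensity (fun y => (f y : ℝ≥0∞))

/-- `f_{ν_i}(y) = ∫ f(y, w) dw`; for `i = k` this is `f`. -/
def fMarg (d : ℕ → ℕ) (k : ℕ) (f : E d k → ℝ≥0) (i : ℕ) (y : E d i) : ℝ≥0∞ :=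
  ∫⁻ w : Tail d k i, (f (glue y w) : ℝ≥0∞)

/-- `f_{ν_{i+1}}(z | y) = f_{ν_{i+1}}(y, z) / f_{ν_i}(y)`. -/
def fCond (d : ℕ → ℕ) (k : ℕ) (f : E d k → ℝ≥0) (i : ℕ) (y : E d i) (z : B d (i + 1)) : ℝ≥0∞ :=
  fMarg d k f (i + 1) (join y z) / fMarg d k f i y

/-- The probability measure `f_{ν_{i+1}}(z | y) dz` on `ℝ^{d_{i+1}}`. -/
def targetCond (d : ℕ → ℕ) (k : ℕ) (f : E d k → ℝ≥0) (i : ℕ) (y : E d i) : Measure (B d (i + 1)) :=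
  volume.withDensity (fCond d k f i y)

/-- The marginal `μ_i` of `μ` on the first `n_i` coordinates. -/
def muMarg {d : ℕ → ℕ} {k : ℕ} (μ : Measure (E d k)) (i : ℕ) (hi : i ≤ k) : Measure (E d i) :=
  μ.map (trunc hi)

/-- The regular conditional probability
`μ_{i+1}(dx_{[n_i + 1, n_{i+1}]} | x_{n_i})`. -/
def muCond {d : ℕ → ℕ} {k : ℕ} (μ : Measure (E d k)) [IsFiniteMeasure μ] (i : ℕ)
    (hi : i + 1 ≤ k) : Kernel (E d i) (B d (i + 1)) :=
  condDistrib (fun x : E d k => lastBlock (trunc hi x)) (trunc (Nat.le_of_succ_le hi)) μ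

/-! ### The conditional measures -/

/-- `h_{i+1}(0, x, y) = ∫ g(z) p_{i+1}(x, (y, z)) dz`, where `g = h_{i+1}(y, ·)`. -/
def hZero (d : ℕ → ℕ) (k : ℕ) (p : E d k → E d k → ℝ) (i : ℕ) (g : B d (i + 1) → ℝ≥0)
    (x : E d (i + 1)) (y : E d i) : ℝ≥0∞ :=
  ∫⁻ z, (g z : ℝ≥0∞) * pMarg d k p (i + 1) x (join y z)

/-- The factor `h_{j+1}(y) p_{j+1}(x, y) / h_{j+1}(0, x, y_{n_j})` for `x, y ∈ ℝ^{n_{j+1}}`. -/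
def factor (d : ℕ → ℕ) (k : ℕ) (p : E d k → E d k → ℝ) (h : (j : ℕ) → E d j → ℝ≥0) (j : ℕ)
    (x y : E d (j + 1)) : ℝ≥0∞ :=
  (h (j + 1) y : ℝ≥0∞) * pMarg d k p (j + 1) x y /
    hZero d k p j (fun z => h (j + 1) (join (trunc (Nat.le_succ j) y) z)) x
      (trunc (Nat.le_succ j) y)

/-- `π_{μ_i,ν_i}(y, dx)
  = f_{ν_i}(y)⁻¹ ∏_{j=1}^i h_j(y_{n_j}) p_j(x_{n_j}, y_{n_j}) / h_j(0, x_{n_j}, y_{n_{j-1}}) μ_i(dx)`,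
a measure on `ℝ^{n_i}` for each `y ∈ ℝ^{n_i}`. -/
def piCond (d : ℕ → ℕ) (k : ℕ) (p : E d k → E d k → ℝ) (μ : Measure (E d k)) (f : E d k → ℝ≥0)
    (h : (j : ℕ) → E d j → ℝ≥0) (i : ℕ) (hi : i ≤ k) (y : E d i) : Measure (E d i) :=
  (muMarg μ i hi).withDensity (fun x => (fMarg d k f i y)⁻¹ *
    ∏ j : Fin i, factor d k p h j (trunc (Nat.succ_le_of_lt j.2) x)
      (trunc (Nat.succ_le_of_lt j.2) y))

/-- `π_{μ_i,ν_i} ⊗ μ_{i+1|i}(y, dx)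
  = π_{μ_i,ν_i}(y, dx_{n_i}) μ_{i+1}(dx_{[n_i + 1, n_{i+1}]} | x_{n_i})`,
a measure on `ℝ^{n_{i+1}}` for each `y ∈ ℝ^{n_i}`. -/
def sourceCond (d : ℕ → ℕ) (k : ℕ) (p : E d k → E d k → ℝ) (μ : Measure (E d k))
    [IsFiniteMeasure μ] (f : E d k → ℝ≥0) (h : (j : ℕ) → E d j → ℝ≥0) (i : ℕ) (hi : i + 1 ≤ k)
    (y : E d i) : Measure (E d (i + 1)) :=
  (piCond d k p μ f h i (Nat.le_of_succ_le hi) y ⊗ₘ muCond μ i hi).map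
    (fun q => join q.1 q.2)

/-- `g = h_{i+1}(y, ·) : ℝ^{d_{i+1}} → [0, ∞)` is a measurable solution of the conditional
Schrödinger equation at `y`, an equality of measures on `ℝ^{d_{i+1}}`:
`f(z | y) dz = g(z) dz ∫ p(x, z | y) / (∫ g(z') p(x, z' | y) dz') Q(dx)`. Here `Q` stands for
`π_{μ_i,ν_i} ⊗ μ_{i+1|i}(y, ·)`. -/
def IsSolution (d : ℕ → ℕ) (k : ℕ) (p : E d k → E d k → ℝ) (f : E d k → ℝ≥0) (i : ℕ)
    (y : E d i) (Q : Measure (E d (i + 1))) (g : B d (i + 1) → ℝ≥0) : Prop :=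
  Measurable g ∧
  targetCond d k f i y = volume.withDensity (fun z => (g z : ℝ≥0∞) *
    ∫⁻ x, pCond d k p i x z y / (∫⁻ z', (g z' : ℝ≥0∞) * pCond d k p i x z' y) ∂Q)

/-- `π_{μ_{i+1},ν_{i+1}}(y, dx dz) = g(z) p_{i+1}(x, (y, z)) / h_{i+1}(0, x, y) Q(dx) dz`, where
`g = h_{i+1}(y, ·)` and `Q` stands for `π_{μ_i,ν_i} ⊗ μ_{i+1|i}(y, ·)`. -/
def planCond (d : ℕ → ℕ) (k : ℕ) (p : E d k → E d k → ℝ) (i : ℕ)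
    (y : E d i) (Q : Measure (E d (i + 1))) (g : B d (i + 1) → ℝ≥0) :
    Measure (E d (i + 1) × B d (i + 1)) :=
  (Q.prod volume).withDensity (fun q =>
    (g q.2 : ℝ≥0∞) * pMarg d k p (i + 1) q.1 (join y q.2) / hZero d k p i g q.1 y)

/-! ### Couplings and the entropy problem -/

/-- `𝒜(P, Q)`: the probability measures with marginals `P` and `Q`. -/
def couplings {α β : Type*} [MeasurableSpace α] [MeasurableSpace β] (P : Measure α)
    (Q : Measure β) : Set (Measure (α × β)) :=
  {π | IsProbabilityMeasure π ∧ π.map Prod.fst = P ∧ π.map Prod.snd = Q}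

/-- `inf {H(π ‖ R) : π ∈ 𝒜(P, Q)}`, with `H` the relative entropy. -/
def entropyValue {α β : Type*} [MeasurableSpace α] [MeasurableSpace β] (P : Measure α)
    (Q : Measure β) (R : Measure (α × β)) : ℝ≥0∞ :=
  ⨅ π ∈ couplings P Q, klDiv π R

/-- `m` is the unique minimizer of `H(· ‖ R)` on `𝒜(P, Q)`. -/
def IsUniqueMinimizer {α β : Type*} [MeasurableSpace α] [MeasurableSpace β] (P : Measure α)
    (Q : Measure β) (R : Measure (α × β)) (m : Measure (α × β)) : Prop :=
  m ∈ couplings P Q ∧ klDiv m R = entropyValue P Q R ∧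
    ∀ π ∈ couplings P Q, klDiv π R = entropyValue P Q R → π = m

/-! ### The joint measures -/

/-- `π ⊗ μ_{i+1|i}(dx_{n_{i+1}} dy_{n_i})
  = π(dx_{n_i} dy_{n_i}) μ_{i+1}(dx_{[n_i + 1, n_{i+1}]} | x_{n_i})`. -/
def extend {d : ℕ → ℕ} {k : ℕ} (μ : Measure (E d k)) [IsFiniteMeasure μ] (i : ℕ)
    (hi : i + 1 ≤ k) (π : Measure (E d i × E d i)) : Measure (E d (i + 1) × E d i) :=
  (π ⊗ₘ Kernel.prodMkRight (E d i) (muCond μ i hi)).map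
    (fun q => (join q.1.1 q.2, q.1.2))

/-- `π ⊗ μ_{i+1|i}(dx_{n_{i+1}} dy_{n_i}) p_{i+1}(x, z | y) dz`, as a measure in
`(x, (y, z)) ∈ ℝ^{n_{i+1}} × ℝ^{n_{i+1}}`. -/
def reference (d : ℕ → ℕ) (k : ℕ) (p : E d k → E d k → ℝ) (μ : Measure (E d k))
    [IsFiniteMeasure μ] (i : ℕ) (hi : i + 1 ≤ k) (π : Measure (E d i × E d i)) :
    Measure (E d (i + 1) × E d (i + 1)) :=
  (((extend μ i hi π).prod volume).withDensity
    (fun q : (E d (i + 1) × E d i) × B d (i + 1) => pCond d k p i q.1.1 q.2 q.1.2)).map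
      (fun q => (q.1.1, join q.1.2 q.2))

/-- The measures `π_{μ_i,ν_i}(dx dy)` on `ℝ^{n_i} × ℝ^{n_i}`, by recursion on `i ≥ 1`:
`π_{μ_1,ν_1} = h_1(y) / (∫ h_1(z) p_1(x, z) dz) μ_1(dx) p_1(x, y) dy`, and `π_{μ_{i+1},ν_{i+1}}` has
density `h_{i+1}(y) / ∫ h_{i+1}(y_{n_i}, z) p_{i+1}(x, z | y_{n_i}) dz` with respect to
`π_{0,i+1}`, the `reference` measure built from `π_{μ_i,ν_i}`. (The value at `i = 0` is not used.) -/
def piJoint (d : ℕ → ℕ) (k : ℕ) (p : E d k → E d k → ℝ) (μ : Measure (E d k))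
    [IsFiniteMeasure μ] (h : (j : ℕ) → E d j → ℝ≥0) :
    (i : ℕ) → i ≤ k → Measure (E d i × E d i)
  | 0, _ => 0
  | 1, hi => ((muMarg μ 1 hi).prod volume).withDensity (fun q =>
      (h 1 q.2 : ℝ≥0∞) / (∫⁻ z : E d 1, (h 1 z : ℝ≥0∞) * pMarg d k p 1 q.1 z) *
        pMarg d k p 1 q.1 q.2)
  | i + 2, hi =>
      (reference d k p μ (i + 1) hi (piJoint d k p μ h (i + 1) (Nat.le_of_succ_le hi))).withDensity
        (fun q => (h (i + 2) q.2 : ℝ≥0∞) /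
          ∫⁻ z : B d (i + 2), (h (i + 2) (join (trunc (Nat.le_succ (i + 1)) q.2) z) : ℝ≥0∞) *
            pCond d k p (i + 1) q.1 z (trunc (Nat.le_succ (i + 1)) q.2))

/-- `π_{μ_i,ν_i} ⊗ μ_{i+1|i}(dx_{n_{i+1}} dy_{n_i})`. -/
def sourceJoint (d : ℕ → ℕ) (k : ℕ) (p : E d k → E d k → ℝ) (μ : Measure (E d k))
    [IsFiniteMeasure μ] (h : (j : ℕ) → E d j → ℝ≥0) (i : ℕ) (hi : i + 1 ≤ k) :
    Measure (E d (i + 1) × E d i) :=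
  extend μ i hi (piJoint d k p μ h i (Nat.le_of_succ_le hi))

/-- `π_{0,i+1}(dx_{n_{i+1}} dy_{n_{i+1}})`. -/
def pi0 (d : ℕ → ℕ) (k : ℕ) (p : E d k → E d k → ℝ) (μ : Measure (E d k))
    [IsFiniteMeasure μ] (h : (j : ℕ) → E d j → ℝ≥0) (i : ℕ) (hi : i + 1 ≤ k) :
    Measure (E d (i + 1) × E d (i + 1)) :=
  reference d k p μ i hi (piJoint d k p μ h i (Nat.le_of_succ_le hi))

/-- `κ` is a version of the regular conditional probability
`π_{μ_i,ν_i} ⊗ μ_{i+1|i}(dx_{n_{i+1}} | y_{n_i})`. -/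
def IsSourceVersion (d : ℕ → ℕ) (k : ℕ) (p : E d k → E d k → ℝ) (μ : Measure (E d k))
    [IsFiniteMeasure μ] (h : (j : ℕ) → E d j → ℝ≥0) (i : ℕ) (hi : i + 1 ≤ k)
    (κ : Kernel (E d i) (E d (i + 1))) : Prop :=
  IsMarkovKernel κ ∧ ((sourceJoint d k p μ h i hi).map Prod.swap).IsCondKernel κ

/-- `κ` is a version of the regular conditional probability
`π_{0,i+1}(dx_{n_{i+1}} dy_{[n_i + 1, n_{i+1}]} | y_{n_i})`. -/
def IsPi0Version (d : ℕ → ℕ) (k : ℕ) (p : E d k → E d k → ℝ) (μ : Measure (E d k))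
    [IsFiniteMeasure μ] (h : (j : ℕ) → E d j → ℝ≥0) (i : ℕ) (hi : i + 1 ≤ k)
    (κ : Kernel (E d i) (E d (i + 1) × B d (i + 1))) : Prop :=
  IsMarkovKernel κ ∧
    ((pi0 d k p μ h i hi).map
      (fun q => (trunc (Nat.le_succ i) q.2, (q.1, lastBlock q.2)))).IsCondKernel κ

end

end CondSchrodinger

/-! Write `K(x, z)` for the conditional kernel. A solution of the equation is the `z`-factor of a
coupling of the two marginals whose density with respect to `K(x, z) Q(dx) dz` has the product form
`a(x) g(z)`.

Existence: for finitely supported marginals, minimizing `∑ m log (m / K)` over the transport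
polytope gives a matrix whose ratio to `K` has unit cross ratios, because moving mass around a
rectangle cannot decrease the entropy. So `K⁻¹ P` is a product measure up to a constant. This
property of `P`, tested against bounded continuous functions, passes to weak limits, which exist
since the marginals converge; an unbounded `K⁻¹` is first made bounded by continuous weights
`u(x) v(z)`, which do not affect the product form.

Minimality and uniqueness: if `dm/dR = a(x) g(z)` and `π` has the marginals of `m`, then
`log dm/dR = log a + log g` has the same integral under `π` and under `m`, so that
`H(π ‖ R) = H(π ‖ m) + H(m ‖ R)`. Hence `m` is the unique minimizer. Two couplings of product form
also have product densities with respect to each other, so the same identity shows that they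
coincide, and `g` is determined up to a constant. -/

namespace CondSchrodinger

noncomputable section

open Filter Topology BoundedContinuousFunction

/-! ### Finite Schrödinger systems -/

section Finite

variable {ι κ : Type*}

/-- The nonnegative matrices with row sums `a` and column sums `b`. -/
def transportPolytope [Fintype ι] [Fintype κ] (a : ι → ℝ) (b : κ → ℝ) : Set (ι × κ → ℝ) :=
  {m | (∀ t, 0 ≤ m t) ∧ (∀ i, ∑ j, m (i, j) = a i) ∧ ∀ j, ∑ i, m (i, j) = b j}

/-- The entropy `∑ m log (m s)` of a matrix `m` relative to the weight `s⁻¹`. -/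
def weightedEntropy [Fintype ι] (s m : ι → ℝ) : ℝ :=
  ∑ t, m t * Real.log (m t * s t)

/-- The matrix with zero row and column sums supported on the rectangle `{i, i'} × {j, j'}`, with
values `1` at `(i, j)`, `(i', j')` and `-1` at `(i, j')`, `(i', j)`. -/
def rectCycle [DecidableEq ι] [DecidableEq κ] (i i' : ι) (j j' : κ) (t : ι × κ) : ℝ :=
  (Pi.single i 1 - Pi.single i' 1 : ι → ℝ) t.1 * (Pi.single j 1 - Pi.single j' 1 : κ → ℝ) t.2

/-- The identity `r(i, j) r(i', j') = r(i, j') r(i', j)` which characterises matrices of rank at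
most one. -/
def HasUnitCrossRatios (r : ι × κ → ℝ) : Prop :=
  ∀ i i' j j', r (i, j) * r (i', j') = r (i, j') * r (i', j)

theorem sum_single_sub_single_mul [Fintype ι] [DecidableEq ι] (i i' : ι) (F : ι → ℝ) :
    ∑ c, (Pi.single i 1 - Pi.single i' 1 : ι → ℝ) c * F c = F i - F i' := by
  simp [sub_mul, Pi.single_apply]

section RectCycle

variable [DecidableEq ι] [DecidableEq κ] (i i' : ι) (j j' : κ)

theorem sum_rectCycle_mul [Fintype ι] [Fintype κ] (F : ι × κ → ℝ) :
    ∑ t, rectCycle i i' j j' t * F t = F (i, j) + F (i', j') - (F (i, j') + F (i', j)) := by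
  simp only [rectCycle, Fintype.sum_prod_type, mul_assoc, ← Finset.mul_sum,
    sum_single_sub_single_mul]
  ring

theorem sum_rectCycle_row [Fintype κ] (c : ι) : ∑ e, rectCycle i i' j j' (c, e) = 0 := by
  simp [rectCycle, ← Finset.mul_sum]

theorem sum_rectCycle_col [Fintype ι] (e : κ) : ∑ c, rectCycle i i' j j' (c, e) = 0 := by
  simp [rectCycle, ← Finset.sum_mul]

variable {i i' j j'}

theorem rectCycle_of_neg {t : ι × κ} (ht : rectCycle i i' j j' t < 0) :
    rectCycle i i' j j' t = -1 ∧ (t = (i, j') ∨ t = (i', j)) := by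
  obtain ⟨c, e⟩ := t
  simp only [rectCycle, Pi.sub_apply, Pi.single_apply, Prod.mk.injEq] at ht ⊢
  split_ifs at ht ⊢ <;> norm_num at ht <;> simp_all

theorem rectCycle_corners (hi : i ≠ i') (hj : j ≠ j') :
    rectCycle i i' j j' (i, j) = 1 ∧ rectCycle i i' j j' (i', j') = 1 ∧
      rectCycle i i' j j' (i, j') = -1 ∧ rectCycle i i' j j' (i', j) = -1 := by
  simp [rectCycle, hi, hi.symm, hj, hj.symm]

end RectCycle

theorem mul_log_tangent_le {a b s : ℝ} (ha : 0 < a) (hb : 0 ≤ b) (hs : 0 < s) :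
    a * Real.log (a * s) + (b - a) * (Real.log (a * s) + 1) ≤ b * Real.log (b * s) := by
  rcases hb.eq_or_lt with rfl | hb
  · linarith
  · have h : b * Real.log (a / b) ≤ b * (a / b - 1) := by
      gcongr
      exact Real.log_le_sub_one_of_pos (by positivity)
    rw [mul_sub, mul_div_cancel₀ _ hb.ne', Real.log_div ha.ne' hb.ne'] at h
    rw [Real.log_mul ha.ne' hs.ne', Real.log_mul hb.ne' hs.ne']
    linarith

theorem continuous_weightedEntropy [Fintype ι] {s : ι → ℝ} (hs : ∀ t, 0 < s t) :
    Continuous (weightedEntropy s) := by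
  refine continuous_finsetSum _ fun t _ => ?_
  have hterm (m : ι → ℝ) :
      m t * Real.log (m t * s t) = (s t)⁻¹ * ((m t * s t) * Real.log (m t * s t)) := by
    field_simp [(hs t).ne']
  simp only [hterm]
  exact continuous_const.mul (Real.continuous_mul_log.comp (by fun_prop))

theorem sum_sub_mul_log_nonneg_of_weightedEntropy_le [Fintype ι] {s m n : ι → ℝ}
    (hs : ∀ t, 0 < s t) (hm : ∀ t, 0 ≤ m t) (hn : ∀ t, 0 < n t ∨ n t = m t)
    (hle : weightedEntropy s m ≤ weightedEntropy s n) :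
    0 ≤ ∑ t, (n t - m t) * (Real.log (n t * s t) + 1) := by
  have htangent (t : ι) : n t * Real.log (n t * s t) - m t * Real.log (m t * s t) ≤
      (n t - m t) * (Real.log (n t * s t) + 1) := by
    rcases hn t with h | h
    · linarith [mul_log_tangent_le h (hm t) (hs t)]
    · simp [h]
  calc 0 ≤ weightedEntropy s n - weightedEntropy s m := sub_nonneg.2 hle
    _ ≤ _ := by
      rw [weightedEntropy, weightedEntropy, ← Finset.sum_sub_distrib]
      exact Finset.sum_le_sum fun t _ => htangent t

variable [Fintype ι] [Fintype κ]

theorem isCompact_transportPolytope (a : ι → ℝ) (b : κ → ℝ) :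
    IsCompact (transportPolytope a b) := by
  have hsub : transportPolytope a b ⊆ Set.Icc 0 (fun t : ι × κ => a t.1) := by
    rintro m ⟨h0, h1, -⟩
    refine ⟨h0, fun t => ?_⟩
    simp only [← h1 t.1]
    exact Finset.single_le_sum (f := fun j => m (t.1, j)) (fun j _ => h0 _) (Finset.mem_univ t.2)
  refine isCompact_Icc.of_isClosed_subset ?_ hsub
  simp only [transportPolytope, Set.ofPred_and, Set.ofPred_forall]
  exact (isClosed_iInter fun t => isClosed_le continuous_const (continuous_apply t)).inter
    ((isClosed_iInter fun i => isClosed_eq (by fun_prop) continuous_const).inter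
      (isClosed_iInter fun j => isClosed_eq (by fun_prop) continuous_const))

theorem nonempty_transportPolytope {a : ι → ℝ} {b : κ → ℝ} (ha : ∀ i, 0 ≤ a i)
    (hb : ∀ j, 0 ≤ b j) (ha1 : ∑ i, a i = 1) (hb1 : ∑ j, b j = 1) :
    (transportPolytope a b).Nonempty :=
  ⟨fun t => a t.1 * b t.2, fun t => mul_nonneg (ha _) (hb _),
    fun i => by simp [← Finset.mul_sum, hb1], fun j => by simp [← Finset.sum_mul, ha1]⟩

/-- Perturbing `m` by `ε` makes it positive on the whole rectangle, so the logarithms are harmless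
even if `m` vanishes at `(i, j)`. -/
theorem crossRatio_le_of_isMinOn_of_perturb {a : ι → ℝ} {b : κ → ℝ} {s m : ι × κ → ℝ}
    (hs : ∀ t, 0 < s t) (hm : m ∈ transportPolytope a b)
    (hmin : IsMinOn (weightedEntropy s) (transportPolytope a b) m) {i i' : ι} {j j' : κ}
    (hi : i ≠ i') (hj : j ≠ j') {ε : ℝ} (hε : 0 < ε) (hε₁ : ε < m (i, j')) (hε₂ : ε < m (i', j)) :
    (m (i, j') - ε) * s (i, j') * ((m (i', j) - ε) * s (i', j)) ≤
      (m (i, j) + ε) * s (i, j) * ((m (i', j') + ε) * s (i', j')) := by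
  classical
  let n t := m t + ε * rectCycle i i' j j' t
  have hn_cases (t : ι × κ) : 0 < n t ∨ n t = m t := by
    rcases lt_trichotomy (rectCycle i i' j j' t) 0 with h | h | h
    · obtain ⟨hval, rfl | rfl⟩ := rectCycle_of_neg h <;>
        exact .inl (by simp only [n, hval]; linarith)
    · exact .inr (by simp [n, h])
    · exact .inl (add_pos_of_nonneg_of_pos (hm.1 t) (mul_pos hε h))
  have hn : n ∈ transportPolytope a b := by
    refine ⟨fun t => (hn_cases t).elim le_of_lt fun h => h ▸ hm.1 t, fun c => ?_, fun e => ?_⟩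
    · simp [n, Finset.sum_add_distrib, hm.2.1, ← Finset.mul_sum, sum_rectCycle_row]
    · simp [n, Finset.sum_add_distrib, hm.2.2, ← Finset.mul_sum, sum_rectCycle_col]
  have hvar := sum_sub_mul_log_nonneg_of_weightedEntropy_le hs hm.1 hn_cases (hmin hn)
  simp only [n, add_sub_cancel_left, mul_assoc, ← Finset.mul_sum, sum_rectCycle_mul] at hvar
  obtain ⟨h₁, h₂, h₃, h₄⟩ := rectCycle_corners hi hj
  simp only [h₁, h₂, h₃, h₄, mul_one, mul_neg, ← sub_eq_add_neg] at hvar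
  have hpos₁ := mul_pos (add_pos_of_nonneg_of_pos (hm.1 (i, j)) hε) (hs (i, j))
  have hpos₂ := mul_pos (add_pos_of_nonneg_of_pos (hm.1 (i', j')) hε) (hs (i', j'))
  have hpos₃ := mul_pos (sub_pos.2 hε₁) (hs (i, j'))
  have hpos₄ := mul_pos (sub_pos.2 hε₂) (hs (i', j))
  rw [← Real.log_le_log_iff (by positivity) (by positivity), Real.log_mul hpos₃.ne' hpos₄.ne',
    Real.log_mul hpos₁.ne' hpos₂.ne']
  linarith [nonneg_of_mul_nonneg_right hvar hε]

theorem crossRatio_le_of_isMinOn {a : ι → ℝ} {b : κ → ℝ} {s m : ι × κ → ℝ}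
    (hs : ∀ t, 0 < s t) (hm : m ∈ transportPolytope a b)
    (hmin : IsMinOn (weightedEntropy s) (transportPolytope a b) m) {i i' : ι} {j j' : κ}
    (hi : i ≠ i') (hj : j ≠ j') :
    m (i, j') * s (i, j') * (m (i', j) * s (i', j)) ≤
      m (i, j) * s (i, j) * (m (i', j') * s (i', j')) := by
  have hnonneg (t : ι × κ) : 0 ≤ m t * s t := mul_nonneg (hm.1 t) (hs t).le
  rcases (hm.1 (i, j')).eq_or_lt with h₁ | h₁
  · simpa [← h₁] using mul_nonneg (hnonneg (i, j)) (hnonneg (i', j'))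
  rcases (hm.1 (i', j)).eq_or_lt with h₂ | h₂
  · simpa [← h₂] using mul_nonneg (hnonneg (i, j)) (hnonneg (i', j'))
  let lhs ε := (m (i, j') - ε) * s (i, j') * ((m (i', j) - ε) * s (i', j))
  let rhs ε := (m (i, j) + ε) * s (i, j) * ((m (i', j') + ε) * s (i', j'))
  have hle : ∀ᶠ ε in 𝓝[>] (0 : ℝ), lhs ε ≤ rhs ε := by
    filter_upwards [self_mem_nhdsWithin, nhdsWithin_le_nhds (Iio_mem_nhds h₁),
      nhdsWithin_le_nhds (Iio_mem_nhds h₂)] with ε hε hε₁ hε₂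
    exact crossRatio_le_of_isMinOn_of_perturb hs hm hmin hi hj hε hε₁ hε₂
  have hlhs : Continuous lhs := by fun_prop
  have hrhs : Continuous rhs := by fun_prop
  simpa [lhs, rhs] using le_of_tendsto_of_tendsto (hlhs.continuousWithinAt (x := 0))
    (hrhs.continuousWithinAt (x := 0)) hle

theorem exists_mem_transportPolytope_hasUnitCrossRatios {a : ι → ℝ} {b : κ → ℝ}
    (ha : ∀ i, 0 ≤ a i) (hb : ∀ j, 0 ≤ b j) (ha1 : ∑ i, a i = 1) (hb1 : ∑ j, b j = 1)
    {s : ι × κ → ℝ} (hs : ∀ t, 0 < s t) :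
    ∃ m ∈ transportPolytope a b, HasUnitCrossRatios fun t => m t * s t := by
  obtain ⟨m, hm, hmin⟩ := (isCompact_transportPolytope a b).exists_isMinOn
    (nonempty_transportPolytope ha hb ha1 hb1) (continuous_weightedEntropy hs).continuousOn
  refine ⟨m, hm, fun i i' j j' => ?_⟩
  rcases eq_or_ne i i' with rfl | hi
  · exact mul_comm _ _
  rcases eq_or_ne j j' with rfl | hj
  · rfl
  exact le_antisymm (crossRatio_le_of_isMinOn hs hm hmin hi hj.symm)
    (crossRatio_le_of_isMinOn hs hm hmin hi hj)

end Finite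

/-! ### Plans whose weighted measure is a product, by approximation -/

section Approximation

theorem exists_coupling_hasUnitCrossRatios {ι κ : Type*} [Finite ι] [Finite κ] [MeasurableSpace ι]
    [MeasurableSpace κ] [MeasurableSingletonClass ι] [MeasurableSingletonClass κ] (a : Measure ι)
    [IsProbabilityMeasure a] (b : Measure κ) [IsProbabilityMeasure b] {s : ι × κ → ℝ}
    (hs : ∀ t, 0 < s t) :
    ∃ P : Measure (ι × κ), P.fst = a ∧ P.snd = b ∧
      HasUnitCrossRatios fun t => P.real {t} * s t := by
  cases nonempty_fintype ι
  cases nonempty_fintype κ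
  obtain ⟨m, ⟨hm, hrow, hcol⟩, hcr⟩ := exists_mem_transportPolytope_hasUnitCrossRatios
    (a := fun i => a.real {i}) (b := fun j => b.real {j}) (fun _ => measureReal_nonneg)
    (fun _ => measureReal_nonneg) (by simp) (by simp) hs
  let P : Measure (ι × κ) := Measure.count.withDensity fun t => ENNReal.ofReal (m t)
  have hP (t : ι × κ) : P {t} = ENNReal.ofReal (m t) := by simp [P]
  refine ⟨P, Measure.ext_of_singleton fun i => ?_, Measure.ext_of_singleton fun j => ?_, ?_⟩
  · rw [Measure.fst_apply (measurableSet_singleton i), ← Set.prod_univ, ← Finset.coe_singleton,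
      ← Finset.coe_univ, ← Finset.coe_product, ← sum_measure_singleton, Finset.sum_product]
    simp only [Finset.sum_singleton, hP, Finset.coe_singleton]
    rw [← ENNReal.ofReal_sum_of_nonneg fun j _ => hm _, hrow, ofReal_measureReal]
  · rw [Measure.snd_apply (measurableSet_singleton j), ← Set.univ_prod, ← Finset.coe_singleton,
      ← Finset.coe_univ, ← Finset.coe_product, ← sum_measure_singleton, Finset.sum_product_right]
    simp only [Finset.sum_singleton, hP, Finset.coe_singleton]
    rw [← ENNReal.ofReal_sum_of_nonneg fun i _ => hm _, hcol, ofReal_measureReal]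
  · simpa only [Measure.real, hP, ENNReal.toReal_ofReal (hm _)] using hcr

variable {X Z : Type*} [MeasurableSpace X] [MeasurableSpace Z]

/-- The measure `s P` is, up to a constant, the product of its marginals. The condition is tested on
bounded continuous functions, so that it passes to weak limits of `P`. -/
def IsWeightedProduct [TopologicalSpace X] [TopologicalSpace Z] (s : X × Z → ℝ)
    (P : Measure (X × Z)) : Prop :=
  ∀ (f : X →ᵇ ℝ) (g : Z →ᵇ ℝ), (∫ t, f t.1 * g t.2 * s t ∂P) * ∫ t, s t ∂P =
    (∫ t, f t.1 * s t ∂P) * ∫ t, g t.2 * s t ∂P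

theorem HasUnitCrossRatios.sum_mul_sum_eq {ι κ : Type*} [Fintype ι] [Fintype κ] {r : ι × κ → ℝ}
    (hr : HasUnitCrossRatios r) (f : ι → ℝ) (g : κ → ℝ) :
    (∑ t, f t.1 * g t.2 * r t) * ∑ t, r t = (∑ t, f t.1 * r t) * ∑ t, g t.2 * r t := by
  simp only [Fintype.sum_prod_type, Finset.sum_mul_sum]
  refine Finset.sum_congr rfl fun i _ => Finset.sum_congr rfl fun i' _ => ?_
  rw [Finset.sum_comm]
  refine Finset.sum_congr rfl fun j _ => Finset.sum_congr rfl fun j' _ => ?_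
  linear_combination f i * g j' * hr i i' j' j

theorem HasUnitCrossRatios.isWeightedProduct_map [TopologicalSpace X] [TopologicalSpace Z]
    [OpensMeasurableSpace (X × Z)] {ι κ : Type*} [Finite ι] [Finite κ]
    [MeasurableSpace ι] [MeasurableSpace κ] [MeasurableSingletonClass ι]
    [MeasurableSingletonClass κ] {P : Measure (ι × κ)} [IsFiniteMeasure P] {e₁ : ι → X} {e₂ : κ → Z}
    {s : X × Z → ℝ} (hs : Continuous s)
    (hP : HasUnitCrossRatios fun t => P.real {t} * s (Prod.map e₁ e₂ t)) :
    IsWeightedProduct s (P.map (Prod.map e₁ e₂)) := by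
  cases nonempty_fintype ι
  cases nonempty_fintype κ
  have hinteg {F : X × Z → ℝ} (hF : Continuous F) :
      ∫ t, F t ∂P.map (Prod.map e₁ e₂) = ∑ t, P.real {t} * F (Prod.map e₁ e₂ t) := by
    rw [integral_map (measurable_of_finite _).aemeasurable hF.measurable.aestronglyMeasurable,
      integral_fintype .of_finite]
    rfl
  intro f g
  rw [hinteg (by fun_prop), hinteg (by fun_prop), hinteg (by fun_prop), hinteg (by fun_prop)]
  simpa only [mul_left_comm, Prod.map_fst, Prod.map_snd] using
    hP.sum_mul_sum_eq (fun i => f (e₁ i)) fun j => g (e₂ j)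

theorem exists_isWeightedProduct_simpleFunc [TopologicalSpace X] [TopologicalSpace Z]
    [OpensMeasurableSpace (X × Z)] [MeasurableSingletonClass X] [MeasurableSingletonClass Z]
    (Q : Measure X) [IsProbabilityMeasure Q] (N : Measure Z) [IsProbabilityMeasure N]
    (T : SimpleFunc X X) (S : SimpleFunc Z Z) {s : X × Z → ℝ}
    (hs : Continuous s) (hs0 : ∀ t, 0 < s t) :
    ∃ P : Measure (X × Z), P.fst = Q.map T ∧ P.snd = N.map S ∧ IsWeightedProduct s P := by
  let T' (x : X) : T.range := ⟨T x, T.mem_range_self x⟩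
  let S' (z : Z) : S.range := ⟨S z, S.mem_range_self z⟩
  have hT : Measurable T' := T.measurable.subtype_mk
  have hS : Measurable S' := S.measurable.subtype_mk
  have := Measure.isProbabilityMeasure_map (μ := Q) hT.aemeasurable
  have := Measure.isProbabilityMeasure_map (μ := N) hS.aemeasurable
  obtain ⟨P, hfst, hsnd, hP⟩ := exists_coupling_hasUnitCrossRatios (Q.map T') (N.map S')
    (s := fun t => s (Prod.map Subtype.val Subtype.val t)) fun _ => hs0 _
  have hPprob : IsProbabilityMeasure P := ⟨by rw [← Measure.fst_univ, hfst, measure_univ]⟩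
  refine ⟨P.map (Prod.map Subtype.val Subtype.val), ?_, ?_, hP.isWeightedProduct_map hs⟩
  · calc (P.map (Prod.map Subtype.val Subtype.val)).fst = P.fst.map Subtype.val := by
          rw [Measure.fst, Measure.fst, Measure.map_map, Measure.map_map] <;> first | rfl | fun_prop
      _ = Q.map T := by rw [hfst, Measure.map_map measurable_subtype_coe hT]; rfl
  · calc (P.map (Prod.map Subtype.val Subtype.val)).snd = P.snd.map Subtype.val := by
          rw [Measure.snd, Measure.snd, Measure.map_map, Measure.map_map] <;> first | rfl | fun_prop
      _ = N.map S := by rw [hsnd, Measure.map_map measurable_subtype_coe hS]; rfl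

theorem IsWeightedProduct.of_tendsto [TopologicalSpace X] [TopologicalSpace Z]
    [OpensMeasurableSpace (X × Z)] {s : X × Z →ᵇ ℝ} {P : ℕ → ProbabilityMeasure (X × Z)}
    {R : ProbabilityMeasure (X × Z)} (hP : ∀ n, IsWeightedProduct s (P n : Measure (X × Z)))
    (hlim : Tendsto P atTop (𝓝 R)) : IsWeightedProduct s (R : Measure (X × Z)) := fun f g => by
  let f' : X × Z →ᵇ ℝ := f.compContinuous ⟨Prod.fst, continuous_fst⟩
  let g' : X × Z →ᵇ ℝ := g.compContinuous ⟨Prod.snd, continuous_snd⟩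
  have hinteg := ProbabilityMeasure.tendsto_iff_forall_integral_tendsto.1 hlim
  exact tendsto_nhds_unique
    (((hinteg (f' * g' * s)).mul (hinteg s)).congr fun n => hP n f g)
    ((hinteg (f' * s)).mul (hinteg (g' * s)))

section CompleteMetric

variable [MetricSpace X] [SecondCountableTopology X] [BorelSpace X]

theorem exists_simpleFunc_tendsto_map (Q : ProbabilityMeasure X) :
    ∃ T : ℕ → SimpleFunc X X, Tendsto (fun n => Q.map (T n).aemeasurable) atTop (𝓝 Q) := by
  obtain ⟨x₀⟩ := Q.nonempty
  let T := SimpleFunc.approxOn id measurable_id Set.univ x₀ (Set.mem_univ _)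
  have hT := tendstoInDistribution_of_ae_tendsto (μ' := (Q : Measure X)) (Z := id)
    (fun n => (T n).aemeasurable) aemeasurable_id
    (.of_forall fun x => SimpleFunc.tendsto_approxOn measurable_id (Set.mem_univ x₀) (by simp))
  have hlim := hT.tendsto
  simp only [Measure.map_id] at hlim
  exact ⟨T, hlim⟩

variable [CompleteSpace X] [MetricSpace Z] [CompleteSpace Z] [SecondCountableTopology Z]
  [BorelSpace Z]

theorem exists_subseq_tendsto_of_tendsto_marginals {P : ℕ → ProbabilityMeasure (X × Z)}
    {Q : ProbabilityMeasure X} {N : ProbabilityMeasure Z}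
    (hQ : Tendsto (fun n => (P n).map measurable_fst.aemeasurable) atTop (𝓝 Q))
    (hN : Tendsto (fun n => (P n).map measurable_snd.aemeasurable) atTop (𝓝 N)) :
    ∃ (R : ProbabilityMeasure (X × Z)) (φ : ℕ → ℕ), Tendsto (P ∘ φ) atTop (𝓝 R) ∧
      R.map measurable_fst.aemeasurable = Q ∧ R.map measurable_snd.aemeasurable = N := by
  have htightX := isTightMeasureSet_of_isCompact_closure
    (hQ.isCompact_insert_range.closure_of_subset (Set.subset_insert _ _))
  have htightZ := isTightMeasureSet_of_isCompact_closure
    (hN.isCompact_insert_range.closure_of_subset (Set.subset_insert _ _))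
  have htight : IsTightMeasureSet
      {((μ : ProbabilityMeasure (X × Z)) : Measure (X × Z)) | μ ∈ Set.range P} := by
    refine IsTightMeasureSet.prodMk (htightX.subset ?_) (htightZ.subset ?_) <;>
      rintro _ ⟨_, ⟨_, ⟨n, rfl⟩, rfl⟩, rfl⟩ <;> exact ⟨_, ⟨n, rfl⟩, rfl⟩
  obtain ⟨R, -, φ, hφ, hR⟩ := (isCompact_closure_of_isTightMeasureSet htight).tendsto_subseq
    fun n => subset_closure (Set.mem_range_self (f := P) n)
  exact ⟨R, φ, hR,
    tendsto_nhds_unique (((ProbabilityMeasure.continuous_map continuous_fst).tendsto R).comp hR)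
      (hQ.comp hφ.tendsto_atTop),
    tendsto_nhds_unique (((ProbabilityMeasure.continuous_map continuous_snd).tendsto R).comp hR)
      (hN.comp hφ.tendsto_atTop)⟩

theorem exists_coupling_isWeightedProduct (Q : Measure X) [IsProbabilityMeasure Q] (N : Measure Z)
    [IsProbabilityMeasure N] (s : X × Z →ᵇ ℝ) (hs : ∀ t, 0 < s t) :
    ∃ P : Measure (X × Z), P.fst = Q ∧ P.snd = N ∧ IsWeightedProduct s P := by
  obtain ⟨T, hT⟩ := exists_simpleFunc_tendsto_map ⟨Q, inferInstance⟩
  obtain ⟨S, hS⟩ := exists_simpleFunc_tendsto_map ⟨N, inferInstance⟩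
  choose P hfst hsnd hP using fun n =>
    exists_isWeightedProduct_simpleFunc Q N (T n) (S n) s.continuous hs
  have hprob (n : ℕ) : IsProbabilityMeasure (P n) :=
    ⟨by rw [← Measure.fst_univ, hfst, Measure.map_apply (T n).measurable .univ,
      Set.preimage_univ, measure_univ]⟩
  obtain ⟨R, φ, hR, hRQ, hRN⟩ := exists_subseq_tendsto_of_tendsto_marginals
    (P := fun n => ⟨P n, hprob n⟩) (hT.congr fun n => Subtype.ext (hfst n).symm)
    (hS.congr fun n => Subtype.ext (hsnd n).symm)
  exact ⟨R, congrArg Subtype.val hRQ, congrArg Subtype.val hRN,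
    .of_tendsto (P := fun n => ⟨P (φ n), hprob _⟩) (fun n => hP (φ n)) hR⟩

end CompleteMetric

theorem IsWeightedProduct.exists_withDensity_eq_prod [TopologicalSpace X] [BorelSpace X]
    [HasOuterApproxClosed X] [TopologicalSpace Z] [BorelSpace Z] [HasOuterApproxClosed Z]
    [OpensMeasurableSpace (X × Z)] {s : X × Z →ᵇ ℝ} (hs : ∀ t, 0 < s t) {P : Measure (X × Z)}
    [IsProbabilityMeasure P] (hP : IsWeightedProduct s P) :
    ∃ (α : Measure X) (β : Measure Z), IsFiniteMeasure α ∧ IsFiniteMeasure β ∧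
      P.withDensity (fun t => ENNReal.ofReal (s t)) = α.prod β := by
  set σ := P.withDensity fun t => ENNReal.ofReal (s t) with hσ
  have hinteg (F : X × Z → ℝ) : ∫ t, F t ∂σ = ∫ t, F t * s t ∂P := by
    rw [hσ, integral_withDensity_eq_integral_toReal_smul
      s.continuous.measurable.ennreal_ofReal (by simp)]
    simp only [ENNReal.toReal_ofReal (hs _).le, smul_eq_mul, mul_comm]
  have hmass : σ.real Set.univ = ∫ t, s t ∂P := by simpa using hinteg fun _ => 1
  have hpos : 0 < ∫ t, s t ∂P := by
    rw [integral_pos_iff_support_of_nonneg (fun t => (hs t).le) (s.integrable P),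
      Set.eq_univ_of_forall (s := Function.support s) fun t => (hs t).ne']
    simp
  have : IsFiniteMeasure σ :=
    isFiniteMeasure_withDensity_ofReal (s.integrable P).hasFiniteIntegral
  have hσ0 : σ ≠ 0 := fun h => hpos.ne (by simpa [h] using hmass)
  have hβ : IsFiniteMeasure ((σ Set.univ)⁻¹ • σ.snd) :=
    Measure.smul_finite _ (ENNReal.inv_ne_top.2 (Measure.measure_univ_ne_zero.2 hσ0))
  refine ⟨σ.fst, (σ Set.univ)⁻¹ • σ.snd, inferInstance, hβ,
    Measure.eq_prod_of_integral_mul_boundedContinuousFunction fun f g => ?_⟩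
  rw [integral_smul_measure, Measure.fst, Measure.snd,
    integral_map measurable_fst.aemeasurable f.continuous.measurable.aestronglyMeasurable,
    integral_map measurable_snd.aemeasurable g.continuous.measurable.aestronglyMeasurable,
    ENNReal.toReal_inv, ← Measure.real, hmass, hinteg, hinteg, hinteg, smul_eq_mul, mul_left_comm,
    inv_mul_eq_div, eq_div_iff hpos.ne']
  exact hP f g

end Approximation

/-! ### Plans with a given density with respect to a product measure -/

section ProductReference

theorem exists_continuous_le_of_monotone {ι : Type*} {S : ℝ → Set ι} (hS : Monotone S) {q : ι → ℝ}
    (hq : ∀ r, ∃ c > 0, ∀ t ∈ S r, c ≤ q t) :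
    ∃ w : ℝ → ℝ, Continuous w ∧ (∀ r, 0 < w r) ∧ (∀ r, w r ≤ 1) ∧ ∀ r, ∀ t ∈ S r, w r ≤ q t := by
  have hconvex (r : ℝ) : Convex ℝ (Set.Ioc 0 1 ∩ ⋂ t ∈ S r, Set.Iic (q t)) :=
    (convex_Ioc 0 1).inter (convex_iInter₂ fun _ _ => convex_Iic _)
  obtain ⟨w, hw⟩ := exists_continuous_forall_mem_convex_of_local_const hconvex fun r => by
    obtain ⟨c, hc0, hc⟩ := hq (r + 1)
    refine ⟨min c 1, ?_⟩
    filter_upwards [Iio_mem_nhds (lt_add_one r)] with r' hr'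
    exact ⟨⟨lt_min hc0 one_pos, min_le_right _ _⟩, Set.mem_iInter₂.2 fun t ht =>
      (min_le_left _ _).trans (hc t (hS (Set.mem_Iio.1 hr').le ht))⟩
  exact ⟨w, w.continuous, fun r => (hw r).1.1, fun r => (hw r).1.2,
    fun r t ht => Set.mem_iInter₂.1 (hw r).2 t ht⟩

variable {X Z : Type*}

theorem exists_continuous_mul_le [PseudoMetricSpace X] [ProperSpace X] [PseudoMetricSpace Z]
    [ProperSpace Z] [Nonempty X] [Nonempty Z] {q : X × Z → ℝ} (hq : Continuous q)
    (hpos : ∀ t, 0 < q t) :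
    ∃ (u : X → ℝ) (v : Z → ℝ), Continuous u ∧ Continuous v ∧ (∀ x, 0 < u x) ∧ (∀ z, 0 < v z) ∧
      ∀ t, u t.1 * v t.2 ≤ q t := by
  obtain ⟨x₀⟩ := ‹Nonempty X›
  obtain ⟨z₀⟩ := ‹Nonempty Z›
  obtain ⟨w, hw, hw0, hw1, hwq⟩ := exists_continuous_le_of_monotone
    (S := fun r => Metric.closedBall (x₀, z₀) r) (fun _ _ => Metric.closedBall_subset_closedBall)
    fun r => (isCompact_closedBall _ _).exists_forall_le' hq.continuousOn (a := 0) fun t _ => hpos t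
  refine ⟨fun x => w (dist x x₀), fun z => w (dist z z₀), by fun_prop, by fun_prop,
    fun x => hw0 _, fun z => hw0 _, fun t => ?_⟩
  have hmin : w (dist t.1 x₀) * w (dist t.2 z₀) ≤ w (max (dist t.1 x₀) (dist t.2 z₀)) := by
    rcases le_total (dist t.1 x₀) (dist t.2 z₀) with h | h
    · rw [max_eq_right h]; exact mul_le_of_le_one_left (hw0 _).le (hw1 _)
    · rw [max_eq_left h]; exact mul_le_of_le_one_right (hw0 _).le (hw1 _)
  exact hmin.trans (hwq _ t (Metric.mem_closedBall.2 Prod.dist_eq.le))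

theorem exists_boundedContinuous_mul_eq [PseudoMetricSpace X] [ProperSpace X] [PseudoMetricSpace Z]
    [ProperSpace Z] [Nonempty X] [Nonempty Z] {q : X × Z → ℝ} (hq : Continuous q)
    (hpos : ∀ t, 0 < q t) :
    ∃ (s : X × Z →ᵇ ℝ) (u : X → ℝ) (v : Z → ℝ), Continuous u ∧ Continuous v ∧ (∀ t, 0 < s t) ∧
      (∀ x, 0 < u x) ∧ (∀ z, 0 < v z) ∧ ∀ t, s t * (u t.1 * v t.2) * q t = 1 := by
  obtain ⟨u, v, hu, hv, hu0, hv0, huv⟩ := exists_continuous_mul_le hq hpos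
  have hs0 (t : X × Z) : 0 < u t.1 * v t.2 / q t := div_pos (mul_pos (hu0 _) (hv0 _)) (hpos t)
  refine ⟨.ofNormedAddCommGroup (fun t => u t.1 * v t.2 / q t)
    (.div₀ (by fun_prop) hq fun t => (hpos t).ne') 1 fun t => ?_, fun x => (u x)⁻¹,
    fun z => (v z)⁻¹, hu.inv₀ fun x => (hu0 x).ne', hv.inv₀ fun z => (hv0 z).ne', hs0,
    fun x => inv_pos.2 (hu0 x), fun z => inv_pos.2 (hv0 z), fun t => ?_⟩
  · rw [Real.norm_of_nonneg (hs0 t).le]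
    exact (div_le_one (hpos t)).2 (huv t)
  · have := (hu0 t.1).ne'
    have := (hv0 t.2).ne'
    have := (hpos t).ne'
    simp only [BoundedContinuousFunction.coe_ofNormedAddCommGroup]
    field_simp

variable [MeasurableSpace X] [MeasurableSpace Z]

theorem fst_prod_withDensity (α : Measure X) (β : Measure Z) [SFinite α] [SFinite β]
    {K : X × Z → ℝ≥0∞} (hK : Measurable K) :
    ((α.prod β).withDensity K).fst = α.withDensity fun x => ∫⁻ z, K (x, z) ∂β := by
  ext A hA
  rw [Measure.fst_apply hA, withDensity_apply _ (measurable_fst hA), withDensity_apply _ hA,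
    ← Set.prod_univ, ← Measure.prod_restrict, lintegral_prod _ hK.aemeasurable,
    Measure.restrict_univ]

theorem snd_prod_withDensity (α : Measure X) (β : Measure Z) [SFinite α] [SFinite β]
    {K : X × Z → ℝ≥0∞} (hK : Measurable K) :
    ((α.prod β).withDensity K).snd = β.withDensity fun z => ∫⁻ x, K (x, z) ∂α := by
  ext A hA
  rw [Measure.snd_apply hA, withDensity_apply _ (measurable_snd hA), withDensity_apply _ hA,
    ← Set.univ_prod, ← Measure.prod_restrict, lintegral_prod_symm _ hK.aemeasurable,
    Measure.restrict_univ]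

theorem exists_prod_withDensity_marginals [MetricSpace X] [ProperSpace X] [BorelSpace X]
    [MetricSpace Z] [ProperSpace Z] [BorelSpace Z] (Q : Measure X) [IsProbabilityMeasure Q]
    (N : Measure Z) [IsProbabilityMeasure N] {q : X × Z → ℝ} (hq : Continuous q)
    (hpos : ∀ t, 0 < q t) :
    ∃ (α : Measure X) (β : Measure Z), SigmaFinite α ∧ SigmaFinite β ∧
      ((α.prod β).withDensity fun t => ENNReal.ofReal (q t)).fst = Q ∧
      ((α.prod β).withDensity fun t => ENNReal.ofReal (q t)).snd = N := by
  have := nonempty_of_isProbabilityMeasure Q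
  have := nonempty_of_isProbabilityMeasure N
  obtain ⟨s, u, v, hu, hv, hs0, hu0, hv0, hsuv⟩ := exists_boundedContinuous_mul_eq hq hpos
  obtain ⟨P, hfst, hsnd, hP⟩ := exists_coupling_isWeightedProduct Q N s hs0
  have hPprob : IsProbabilityMeasure P := ⟨by rw [← Measure.fst_univ, hfst, measure_univ]⟩
  obtain ⟨α, β, hα, hβ, hprod⟩ := hP.exists_withDensity_eq_prod hs0
  have hsm : Measurable fun t => ENNReal.ofReal (s t) := by fun_prop
  have hum : Measurable fun x => ENNReal.ofReal (u x) := by fun_prop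
  have hvm : Measurable fun z => ENNReal.ofReal (v z) := by fun_prop
  have hqm : Measurable fun t => ENNReal.ofReal (q t) := by fun_prop
  have hPeq : ((α.withDensity fun x => ENNReal.ofReal (u x)).prod
      (β.withDensity fun z => ENNReal.ofReal (v z))).withDensity
        (fun t => ENNReal.ofReal (q t)) = P := by
    rw [prod_withDensity hum hvm, ← hprod, ← withDensity_mul _ hsm (by fun_prop),
      ← withDensity_mul _ (by fun_prop) hqm]
    conv_rhs => rw [← withDensity_one (μ := P)]
    congr 1
    funext t
    simp only [Pi.mul_apply, Pi.one_apply, ← ENNReal.ofReal_mul (hu0 _).le,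
      ← ENNReal.ofReal_mul (hs0 _).le, ← ENNReal.ofReal_mul (mul_pos (hs0 _)
        (mul_pos (hu0 _) (hv0 _))).le, hsuv, ENNReal.ofReal_one]
  exact ⟨_, _, SigmaFinite.withDensity_ofReal _, SigmaFinite.withDensity_ofReal _,
    hPeq ▸ hfst, hPeq ▸ hsnd⟩

end ProductReference

/-! ### The relative entropy of couplings -/

section Entropy

variable {Ω : Type*} [MeasurableSpace Ω]

theorem integrable_of_tendsto_of_integral_le {μ : Measure Ω} {F : ℕ → Ω → ℝ} {G : Ω → ℝ} {C : ℝ}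
    (hF : ∀ n, Integrable (F n) μ) (hF0 : ∀ n ω, 0 ≤ F n ω) (hC : ∀ n, ∫ ω, F n ω ∂μ ≤ C)
    (hlim : ∀ ω, Tendsto (fun n => F n ω) atTop (𝓝 (G ω))) : Integrable G μ := by
  refine ⟨aestronglyMeasurable_of_tendsto_ae _ (fun n => (hF n).1) (.of_forall hlim), ?_⟩
  calc ∫⁻ ω, ‖G ω‖ₑ ∂μ = ∫⁻ ω, liminf (fun n => ‖F n ω‖ₑ) atTop ∂μ := by
        simp only [fun ω => (hlim ω).enorm.liminf_eq]
    _ ≤ liminf (fun n => ∫⁻ ω, ‖F n ω‖ₑ ∂μ) atTop :=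
        lintegral_liminf_le' fun n => (hF n).1.enorm
    _ ≤ liminf (fun _ : ℕ => ENNReal.ofReal C) atTop := by
        refine liminf_le_liminf (.of_forall fun n => ?_)
        rw [← ofReal_integral_norm_eq_lintegral_enorm (hF n)]
        simp only [Real.norm_of_nonneg (hF0 n _)]
        exact ENNReal.ofReal_le_ofReal (hC n)
    _ < ∞ := by simp

theorem posPart_le_of_mem_uIcc_zero {a b : ℝ} (h : a ∈ Set.uIcc 0 b) : a⁺ ≤ b⁺ :=
  sup_le (h.2.trans (sup_comm _ _).le) (posPart_nonneg b)

theorem negPart_le_of_mem_uIcc_zero {a b : ℝ} (h : a ∈ Set.uIcc 0 b) : a⁻ ≤ b⁻ := by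
  simpa only [posPart_neg] using posPart_le_of_mem_uIcc_zero (a := -a) (b := -b)
    (by simpa using (Set.image_neg_uIcc (0 : ℝ) b).subset (Set.mem_image_of_mem _ h))

theorem integrable_of_posPart_of_negPart {μ : Measure Ω} {L : Ω → ℝ}
    (hpos : Integrable (fun ω => (L ω)⁺) μ) (hneg : Integrable (fun ω => (L ω)⁻) μ) :
    Integrable L μ :=
  (hpos.sub hneg).congr (.of_forall fun ω => posPart_sub_negPart (L ω))

variable {π m : Measure Ω} {T : ℕ → Ω → ℝ} {L : Ω → ℝ}

theorem integrable_of_integral_eq_of_tendsto (hTπ : ∀ n, Integrable (T n) π)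
    (hTm : ∀ n, Integrable (T n) m) (hT : ∀ n, ∫ ω, T n ω ∂π = ∫ ω, T n ω ∂m)
    (hTL : ∀ n ω, T n ω ∈ Set.uIcc 0 (L ω)) (hlim : ∀ ω, Tendsto (fun n => T n ω) atTop (𝓝 (L ω)))
    (hpos : Integrable (fun ω => (L ω)⁺) π) (hneg : Integrable (fun ω => (L ω)⁻) m) :
    Integrable L m := by
  have hTpos (n : ℕ) : Integrable (fun ω => (T n ω)⁺) m := (hTm n).pos_part
  have hTneg (n : ℕ) : Integrable (fun ω => (T n ω)⁻) m := (hTm n).neg_part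
  refine integrable_of_posPart_of_negPart (integrable_of_tendsto_of_integral_le hTpos
    (fun n ω => posPart_nonneg _) (C := ∫ ω, (L ω)⁺ ∂π + ∫ ω, (L ω)⁻ ∂m) (fun n => ?_)
    fun ω => (hlim ω).max tendsto_const_nhds) hneg
  calc ∫ ω, (T n ω)⁺ ∂m = ∫ ω, T n ω ∂m + ∫ ω, (T n ω)⁻ ∂m := by
        rw [← integral_add (hTm n) (hTneg n)]
        simp only [eq_sub_iff_add_eq.1 (posPart_sub_negPart _).symm]
    _ = ∫ ω, T n ω ∂π + ∫ ω, (T n ω)⁻ ∂m := by rw [hT]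
    _ ≤ ∫ ω, (L ω)⁺ ∂π + ∫ ω, (L ω)⁻ ∂m := add_le_add
        (integral_mono (hTπ n) hpos fun ω =>
          (le_posPart _).trans (posPart_le_of_mem_uIcc_zero (hTL n ω)))
        (integral_mono (hTneg n) hneg fun ω => negPart_le_of_mem_uIcc_zero (hTL n ω))

theorem integral_eq_of_integral_eq_of_tendsto (hTπ : ∀ n, Integrable (T n) π)
    (hTm : ∀ n, Integrable (T n) m) (hT : ∀ n, ∫ ω, T n ω ∂π = ∫ ω, T n ω ∂m)
    (hTL : ∀ n ω, T n ω ∈ Set.uIcc 0 (L ω)) (hlim : ∀ ω, Tendsto (fun n => T n ω) atTop (𝓝 (L ω)))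
    (hpos : Integrable (fun ω => (L ω)⁺) π) (hneg : Integrable (fun ω => (L ω)⁻) m) :
    Integrable L π ∧ Integrable L m ∧ ∫ ω, L ω ∂π = ∫ ω, L ω ∂m := by
  have hLm : Integrable L m :=
    integrable_of_integral_eq_of_tendsto hTπ hTm hT hTL hlim hpos hneg
  have hLπ : Integrable (-L) π := integrable_of_integral_eq_of_tendsto (T := fun n => -T n)
    (fun n => (hTm n).neg) (fun n => (hTπ n).neg)
    (fun n => by simp only [Pi.neg_apply, integral_neg, hT n])
    (fun n ω => by
      simpa using (Set.image_neg_uIcc (0 : ℝ) (L ω)).subset (Set.mem_image_of_mem _ (hTL n ω)))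
    (fun ω => (hlim ω).neg) (by simpa using hneg) (by simpa using hpos)
  have hlimint {ξ : Measure Ω} (hL : Integrable L ξ) (hTξ : ∀ n, Integrable (T n) ξ) :
      Tendsto (fun n => ∫ ω, T n ω ∂ξ) atTop (𝓝 (∫ ω, L ω ∂ξ)) :=
    tendsto_integral_of_dominated_convergence _ (fun n => (hTξ n).1) hL.norm
      (fun n => .of_forall fun ω => by
        simpa using Set.abs_sub_left_of_mem_uIcc (hTL n ω)) (.of_forall hlim)
  have hLπ := integrable_neg_iff.1 hLπ
  exact ⟨hLπ, hLm, tendsto_nhds_unique (hlimint hLπ hTπ)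
    ((hlimint hLm hTm).congr fun n => (hT n).symm)⟩

/-- Truncation of a real number to `[-n, n]`. -/
def clip (n : ℕ) (a : ℝ) : ℝ := max (-n) (min a n)

theorem measurable_clip (n : ℕ) : Measurable (clip n) := by unfold clip; fun_prop

theorem abs_clip_le (n : ℕ) (a : ℝ) : |clip n a| ≤ n :=
  abs_le.2 ⟨le_max_left _ _, max_le (neg_le_self n.cast_nonneg) (min_le_right _ _)⟩

theorem clip_eventually_eq (a : ℝ) : ∀ᶠ n : ℕ in atTop, clip n a = a := by
  filter_upwards [eventually_ge_atTop ⌈|a|⌉₊] with n hn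
  obtain ⟨hlo, hhi⟩ := abs_le.1 (Nat.ceil_le.1 hn)
  rw [clip, min_eq_left hhi, max_eq_right hlo]

theorem clip_add_clip_mem_uIcc (n : ℕ) (a b : ℝ) : clip n a + clip n b ∈ Set.uIcc 0 (a + b) := by
  have : (0 : ℝ) ≤ n := n.cast_nonneg
  unfold clip
  grind [Set.mem_uIcc]

variable {X Z : Type*} [MeasurableSpace X] [MeasurableSpace Z]

theorem integral_add_eq_of_fst_eq_of_snd_eq {π m : Measure (X × Z)} [IsFiniteMeasure π]
    [IsFiniteMeasure m] (hfst : π.fst = m.fst) (hsnd : π.snd = m.snd) {V : X → ℝ} {U : Z → ℝ}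
    (hV : Measurable V) (hU : Measurable U)
    (hpos : Integrable (fun t : X × Z => (V t.1 + U t.2)⁺) π)
    (hneg : Integrable (fun t : X × Z => (V t.1 + U t.2)⁻) m) :
    Integrable (fun t : X × Z => V t.1 + U t.2) π ∧
      Integrable (fun t : X × Z => V t.1 + U t.2) m ∧
      ∫ t, V t.1 + U t.2 ∂π = ∫ t, V t.1 + U t.2 ∂m := by
  have hVm (n : ℕ) : Measurable fun x => clip n (V x) := (measurable_clip n).comp hV
  have hUm (n : ℕ) : Measurable fun z => clip n (U z) := (measurable_clip n).comp hU
  have hintV (n : ℕ) (ξ : Measure (X × Z)) [IsFiniteMeasure ξ] :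
      Integrable (fun t : X × Z => clip n (V t.1)) ξ :=
    .of_bound ((hVm n).comp measurable_fst).aestronglyMeasurable n
      (.of_forall fun _ => abs_clip_le n _)
  have hintU (n : ℕ) (ξ : Measure (X × Z)) [IsFiniteMeasure ξ] :
      Integrable (fun t : X × Z => clip n (U t.2)) ξ :=
    .of_bound ((hUm n).comp measurable_snd).aestronglyMeasurable n
      (.of_forall fun _ => abs_clip_le n _)
  have hmarg (n : ℕ) (ξ : Measure (X × Z)) [IsFiniteMeasure ξ] :
      ∫ t, clip n (V t.1) + clip n (U t.2) ∂ξ =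
        ∫ x, clip n (V x) ∂ξ.fst + ∫ z, clip n (U z) ∂ξ.snd := by
    rw [integral_add (hintV n ξ) (hintU n ξ), Measure.fst, Measure.snd,
      integral_map measurable_fst.aemeasurable (hVm n).aestronglyMeasurable,
      integral_map measurable_snd.aemeasurable (hUm n).aestronglyMeasurable]
  exact integral_eq_of_integral_eq_of_tendsto (fun n => (hintV n π).add (hintU n π))
    (fun n => (hintV n m).add (hintU n m)) (fun n => by simp only [Pi.add_apply, hmarg, hfst, hsnd])
    (fun n t => clip_add_clip_mem_uIcc n _ _)
    (fun t => tendsto_const_nhds.congr' (((clip_eventually_eq (V t.1)).and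
      (clip_eventually_eq (U t.2))).mono fun n hn => by
        simp only [Pi.add_apply, hn.1, hn.2])) hpos hneg

theorem integrable_negPart_llr {μ ν : Measure Ω} [IsFiniteMeasure μ] [IsFiniteMeasure ν]
    (hμν : μ ≪ ν) : Integrable (fun ω => (llr μ ν ω)⁻) μ := by
  have hm : Measurable fun ω => (llr μ ν ω)⁻ := (measurable_llr μ ν).neg.max measurable_const
  refine ⟨hm.aestronglyMeasurable, ?_⟩
  rw [hasFiniteIntegral_iff_ofReal (.of_forall fun ω => negPart_nonneg _),
    ← lintegral_rnDeriv_mul hμν hm.ennreal_ofReal.aemeasurable]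
  refine (lintegral_mono_ae (g := fun _ => 1) ?_).trans_lt (by simp)
  filter_upwards [Measure.rnDeriv_lt_top μ ν] with ω hω
  have hlog {r : ℝ} (hr : 0 ≤ r) : r * (Real.log r)⁻ ≤ 1 := by
    rcases hr.eq_or_lt with rfl | hr
    · simp
    · rw [negPart_def, mul_max_of_nonneg _ _ hr.le]
      refine max_le ?_ (by simp)
      calc r * -Real.log r = r * Real.log r⁻¹ := by rw [Real.log_inv]
        _ ≤ r * (r⁻¹ - 1) := by gcongr; exact Real.log_le_sub_one_of_pos (inv_pos.2 hr)
        _ ≤ 1 := by rw [mul_sub, mul_inv_cancel₀ hr.ne']; linarith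
  rw [← ENNReal.ofReal_toReal hω.ne, ← ENNReal.ofReal_mul ENNReal.toReal_nonneg,
    ← ENNReal.ofReal_one]
  exact ENNReal.ofReal_le_ofReal (hlog ENNReal.toReal_nonneg)

theorem llr_ae_eq_llr_add_llr {π m R : Measure Ω} [SigmaFinite π] [SigmaFinite m] [SigmaFinite R]
    (hπm : π ≪ m) (hmR : m ≪ R) : llr π R =ᵐ[π] fun ω => llr π m ω + llr m R ω := by
  have hπR := hπm.trans hmR
  filter_upwards [hπR.ae_le (Measure.rnDeriv_mul_rnDeriv (κ := R) hπm), Measure.rnDeriv_pos hπm,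
    hπm.ae_le (Measure.rnDeriv_lt_top π m), hπm.ae_le (Measure.rnDeriv_pos hmR),
    hπR.ae_le (Measure.rnDeriv_lt_top m R)] with ω hmul hπpos hπtop hmpos hmtop
  simp only [llr]
  rw [← hmul, Pi.mul_apply, ENNReal.toReal_mul, Real.log_mul
    (ENNReal.toReal_pos hπpos.ne' hπtop.ne).ne' (ENNReal.toReal_pos hmpos.ne' hmtop.ne).ne']

theorem klDiv_eq_klDiv_add_klDiv {π m R : Measure (X × Z)} [IsProbabilityMeasure π]
    [IsProbabilityMeasure m] [IsFiniteMeasure R] (hfst : π.fst = m.fst) (hsnd : π.snd = m.snd)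
    (hπm : π ≪ m) (hmR : m ≪ R) {V : X → ℝ} {U : Z → ℝ} (hV : Measurable V) (hU : Measurable U)
    (hL : ∀ᵐ t ∂m, llr m R t = V t.1 + U t.2) (hfin : klDiv π R ≠ ∞) :
    klDiv π R = klDiv π m + klDiv m R := by
  obtain ⟨hπR, hi⟩ := klDiv_ne_top_iff.1 hfin
  have hchain : ∀ᵐ t ∂π, llr π R t = llr π m t + (V t.1 + U t.2) := by
    filter_upwards [llr_ae_eq_llr_add_llr hπm hmR, hπm.ae_le hL] with t hadd hsum
    rw [hadd, ← hsum]
  have hneg : Integrable (fun t : X × Z => (V t.1 + U t.2)⁻) m :=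
    (integrable_negPart_llr hmR).congr (hL.mono fun t ht => by simp only [ht])
  have hpos : Integrable (fun t : X × Z => (V t.1 + U t.2)⁺) π := by
    refine (hi.abs.add (integrable_negPart_llr hπm)).mono'
      (((hV.comp measurable_fst).add (hU.comp measurable_snd)).max
        measurable_const).aestronglyMeasurable ?_
    filter_upwards [hchain] with t ht
    rw [Real.norm_of_nonneg (posPart_nonneg _)]
    refine max_le ?_ (add_nonneg (abs_nonneg _) (negPart_nonneg _))
    simp only [Pi.add_apply]
    linarith [le_abs_self (llr π R t), neg_le_negPart (llr π m t)]
  obtain ⟨hLπ, hLm, hLeq⟩ := integral_add_eq_of_fst_eq_of_snd_eq hfst hsnd hV hU hpos hneg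
  have hllrm : Integrable (llr m R) m := hLm.congr (hL.mono fun t ht => ht.symm)
  have hllrπ : Integrable (llr π m) π := (hi.sub hLπ).congr (hchain.mono fun t ht => by
    simp only [Pi.sub_apply, ht, add_sub_cancel_right])
  rw [klDiv_of_ac_of_integrable hπR hi, klDiv_of_ac_of_integrable hπm hllrπ,
    klDiv_of_ac_of_integrable hmR hllrm,
    ← ENNReal.ofReal_add (integral_llr_add_sub_measure_univ_nonneg hπm hllrπ)
      (integral_llr_add_sub_measure_univ_nonneg hmR hllrm),
    integral_congr_ae hchain, integral_congr_ae hL, integral_add hllrπ hLπ, hLeq]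
  congr 1
  simp only [probReal_univ]
  ring

end Entropy

section ProductDensity

variable {X Z : Type*} [MeasurableSpace X] [MeasurableSpace Z] {R m π : Measure (X × Z)}
  {u : X → ℝ≥0} {v : Z → ℝ≥0}

/-- `m` has a density of the form `u x * v z` with respect to `R`, the shape of the minimizers of
the entropy relative to `R` under constraints on the marginals. As `u` and `v` are finite, they are
nonzero `m`-almost everywhere without further assumptions. -/
def HasProductDensity (m R : Measure (X × Z)) : Prop :=
  ∃ (u : X → ℝ≥0) (v : Z → ℝ≥0), Measurable u ∧ Measurable v ∧
    m = R.withDensity fun t => ((u t.1 * v t.2 : ℝ≥0) : ℝ≥0∞)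

theorem ae_mul_ne_zero_of_fst_eq_of_snd_eq (hu : Measurable u) (hv : Measurable v)
    (hm : m = R.withDensity fun t => ((u t.1 * v t.2 : ℝ≥0) : ℝ≥0∞))
    (hfst : π.fst = m.fst) (hsnd : π.snd = m.snd) : ∀ᵐ t ∂π, u t.1 * v t.2 ≠ 0 := by
  have hw : Measurable fun t : X × Z => ((u t.1 * v t.2 : ℝ≥0) : ℝ≥0∞) := by fun_prop
  have hne : ∀ᵐ t ∂m, u t.1 ≠ 0 ∧ v t.2 ≠ 0 := by
    rw [hm, ae_withDensity_iff hw]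
    exact .of_forall fun t ht => mul_ne_zero_iff.1 (ENNReal.coe_ne_zero.1 ht)
  have hune : ∀ᵐ x ∂π.fst, u x ≠ 0 := by
    rw [hfst]
    exact (ae_map_iff measurable_fst.aemeasurable (hu (measurableSet_singleton 0).compl)).2
      (hne.mono fun t ht => ht.1)
  have hvne : ∀ᵐ z ∂π.snd, v z ≠ 0 := by
    rw [hsnd]
    exact (ae_map_iff measurable_snd.aemeasurable (hv (measurableSet_singleton 0).compl)).2
      (hne.mono fun t ht => ht.2)
  filter_upwards [ae_of_ae_map measurable_fst.aemeasurable hune,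
    ae_of_ae_map measurable_snd.aemeasurable hvne] with t htu htv
  exact mul_ne_zero htu htv

theorem HasProductDensity.absolutelyContinuous_left (h : HasProductDensity m R) : m ≪ R := by
  obtain ⟨u, v, -, -, rfl⟩ := h
  exact withDensity_absolutelyContinuous _ _

theorem HasProductDensity.absolutelyContinuous_right (h : HasProductDensity m R)
    (hfst : π.fst = m.fst) (hsnd : π.snd = m.snd) (hπ : π ≪ R) : π ≪ m := by
  obtain ⟨u, v, hu, hv, hm⟩ := h
  intro A hA
  rw [hm, withDensity_apply_eq_zero (by fun_prop)] at hA
  refine measure_mono_null (fun t ht => ?_) (measure_union_null (hπ hA)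
    (ae_iff.1 (ae_mul_ne_zero_of_fst_eq_of_snd_eq hu hv hm hfst hsnd)))
  exact (em' (u t.1 * v t.2 ≠ 0)).symm.imp_left fun h0 => ⟨ENNReal.coe_ne_zero.2 h0, ht⟩

theorem HasProductDensity.klDiv_eq_add [IsProbabilityMeasure π] [IsProbabilityMeasure m]
    [IsFiniteMeasure R] (h : HasProductDensity m R) (hfst : π.fst = m.fst) (hsnd : π.snd = m.snd)
    (hfin : klDiv π R ≠ ∞) : klDiv π R = klDiv π m + klDiv m R := by
  have hmR := h.absolutelyContinuous_left
  have hπm := h.absolutelyContinuous_right hfst hsnd (klDiv_ne_top_iff.1 hfin).1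
  obtain ⟨u, v, hu, hv, hm⟩ := h
  refine klDiv_eq_klDiv_add_klDiv hfst hsnd hπm hmR (V := fun x => Real.log (u x))
    (U := fun z => Real.log (v z)) (by fun_prop) (by fun_prop) ?_ hfin
  have hrn : m.rnDeriv R =ᵐ[R] fun t => ((u t.1 * v t.2 : ℝ≥0) : ℝ≥0∞) := by
    rw [hm]; exact Measure.rnDeriv_withDensity R (by fun_prop)
  filter_upwards [hmR.ae_le hrn, ae_mul_ne_zero_of_fst_eq_of_snd_eq hu hv hm rfl rfl] with t ht h0
  rw [llr, ht, ENNReal.coe_toReal, NNReal.coe_mul,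
    Real.log_mul (NNReal.coe_ne_zero.2 (left_ne_zero_of_mul h0))
      (NNReal.coe_ne_zero.2 (right_ne_zero_of_mul h0))]

theorem HasProductDensity.isUniqueMinimizer {Q : Measure X} {N : Measure Z} [IsFiniteMeasure R]
    (h : HasProductDensity m R) (hm : m ∈ couplings Q N) (hfin : entropyValue Q N R < ∞) :
    IsUniqueMinimizer Q N R m := by
  obtain ⟨hprob, hfst, hsnd⟩ := hm
  have hpyth {π : Measure (X × Z)} (hπ : π ∈ couplings Q N) (hne : klDiv π R ≠ ∞) :
      klDiv π R = klDiv π m + klDiv m R :=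
    have := hπ.1
    h.klDiv_eq_add (hπ.2.1.trans hfst.symm) (hπ.2.2.trans hsnd.symm) hne
  have hval : klDiv m R = entropyValue Q N R := by
    refine le_antisymm (le_iInf₂ fun π hπ => ?_) (iInf₂_le m ⟨hprob, hfst, hsnd⟩)
    obtain htop | hne := eq_or_ne (klDiv π R) ∞
    · exact htop ▸ le_top
    · exact (hpyth hπ hne).symm ▸ le_add_self
  refine ⟨⟨hprob, hfst, hsnd⟩, hval, fun π hπ hπval => ?_⟩
  have := hπ.1
  have hpythπ := hpyth hπ (hπval ▸ hfin.ne)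
  rw [hπval, hval] at hpythπ
  exact klDiv_eq_zero_iff.1
    ((ENNReal.add_left_inj hfin.ne).1 ((zero_add _).trans hpythπ)).symm

theorem HasProductDensity.of_common_reference {m' : Measure (X × Z)} (h : HasProductDensity m R)
    (h' : HasProductDensity m' R) (hfst : m'.fst = m.fst) (hsnd : m'.snd = m.snd) :
    HasProductDensity m' m := by
  obtain ⟨u, v, hu, hv, hm⟩ := h
  obtain ⟨u', v', hu', hv', hm'⟩ := h'
  refine ⟨fun x => u' x / u x, fun z => v' z / v z, by fun_prop, by fun_prop, ?_⟩
  have hne : ∀ᵐ t ∂ R, u' t.1 * v' t.2 ≠ 0 → u t.1 * v t.2 ≠ 0 := by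
    have hae := ae_mul_ne_zero_of_fst_eq_of_snd_eq hu hv hm hfst hsnd
    rw [hm', ae_withDensity_iff (by fun_prop)] at hae
    simpa only [ne_eq, ENNReal.coe_eq_zero] using hae
  rw [hm, ← withDensity_mul _ (by fun_prop) (by fun_prop), hm']
  refine withDensity_congr_ae (hne.mono fun t ht => ?_)
  simp only [Pi.mul_apply, ← ENNReal.coe_mul, ENNReal.coe_inj, div_mul_div_comm]
  by_cases h0 : u t.1 * v t.2 = 0
  · rw [h0, zero_mul, not_not.1 (mt ht (not_not.2 h0))]
  · exact (mul_div_cancel₀ _ h0).symm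

theorem HasProductDensity.eq_of_fst_eq_of_snd_eq {m' : Measure (X × Z)} [IsProbabilityMeasure m]
    [IsProbabilityMeasure m'] (h : HasProductDensity m R) (h' : HasProductDensity m' R)
    (hfst : m'.fst = m.fst) (hsnd : m'.snd = m.snd) : m' = m := by
  have hself : klDiv m m = 0 := klDiv_self m
  have hpyth := (h.of_common_reference h' hfst hsnd).klDiv_eq_add hfst.symm hsnd.symm
    (hself.trans_ne ENNReal.zero_ne_top)
  exact (klDiv_eq_zero_iff.1 (add_eq_zero.1 (hpyth.symm.trans hself)).1).symm

end ProductDensity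

/-! ### The Schrödinger equation -/

section Schrodinger

theorem lintegral_ne_zero_of_forall_ne_zero {Ω : Type*} [MeasurableSpace Ω] {μ : Measure Ω}
    (hμ : μ ≠ 0) {f : Ω → ℝ≥0∞} (hf : Measurable f) (h : ∀ ω, f ω ≠ 0) : ∫⁻ ω, f ω ∂μ ≠ 0 := by
  rw [Ne, lintegral_eq_zero_iff hf]
  exact fun h0 => hμ (ae_eq_bot.1 (eventually_false_iff_eq_bot.1 (h0.mono h)))

variable {X Z : Type*} [MeasurableSpace Z] {ℓ : Measure Z} {K : X × Z → ℝ≥0∞} {g g' : Z → ℝ≥0}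

/-- The potential `x ↦ ∫ g(z) K(x, z) ℓ(dz)` of `g`. -/
def potential (ℓ : Measure Z) (K : X × Z → ℝ≥0∞) (g : Z → ℝ≥0) (x : X) : ℝ≥0∞ :=
  ∫⁻ z, (g z : ℝ≥0∞) * K (x, z) ∂ℓ

theorem potential_eq_of_ae_eq_const_mul {c : ℝ≥0} (heq : g' =ᵐ[ℓ] fun z => c * g z) (x : X) :
    potential ℓ K g' x = c * potential ℓ K g x := by
  rw [potential, potential, ← lintegral_const_mul' _ _ ENNReal.coe_ne_top]
  refine lintegral_congr_ae (heq.mono fun z hz => ?_)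
  simp only [hz, ENNReal.coe_mul, mul_assoc]

variable [MeasurableSpace X] {Q : Measure X} {N : Measure Z}

/-- `g` is a measurable solution of the Schrödinger equation
`N(dz) = g(z) ℓ(dz) ∫ K(x, z) / (∫ g(z') K(x, z') ℓ(dz')) Q(dx)` with kernel `K` and marginals
`Q`, `N`. -/
def IsSchrodinger (ℓ : Measure Z) (Q : Measure X) (N : Measure Z) (K : X × Z → ℝ≥0∞)
    (g : Z → ℝ≥0) : Prop :=
  Measurable g ∧
    N = ℓ.withDensity fun z => (g z : ℝ≥0∞) * ∫⁻ x, K (x, z) / potential ℓ K g x ∂Q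

/-- The measure `g(z) K(x, z) / (∫ g(z') K(x, z') ℓ(dz')) Q(dx) ℓ(dz)`. -/
def schrodingerPlan (ℓ : Measure Z) (Q : Measure X) (K : X × Z → ℝ≥0∞) (g : Z → ℝ≥0) :
    Measure (X × Z) :=
  (Q.prod ℓ).withDensity fun t => (g t.2 : ℝ≥0∞) * K t / potential ℓ K g t.1

theorem IsSchrodinger.of_ae_eq_const_mul (h : IsSchrodinger ℓ Q N K g) (hg' : Measurable g')
    {c : ℝ≥0} (hc : 0 < c) (heq : g' =ᵐ[ℓ] fun z => c * g z) : IsSchrodinger ℓ Q N K g' := by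
  refine ⟨hg', h.2.trans (withDensity_congr_ae (heq.mono fun z hz => ?_))⟩
  have hc0 : (c : ℝ≥0∞) ≠ 0 := ENNReal.coe_ne_zero.2 hc.ne'
  have hdiv (x : X) :
      K (x, z) / potential ℓ K g' x = (c : ℝ≥0∞)⁻¹ * (K (x, z) / potential ℓ K g x) := by
    rw [potential_eq_of_ae_eq_const_mul heq, div_eq_mul_inv, div_eq_mul_inv,
      ENNReal.mul_inv (.inl hc0) (.inl ENNReal.coe_ne_top), mul_left_comm]
  simp only [hdiv]
  rw [lintegral_const_mul' _ _ (ENNReal.inv_ne_top.2 hc0), hz, ENNReal.coe_mul,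
    mul_mul_mul_comm, ENNReal.mul_inv_cancel hc0 ENNReal.coe_ne_top, one_mul]

variable [SigmaFinite ℓ]

theorem measurable_potential (hK : Measurable K) (hg : Measurable g) :
    Measurable (potential ℓ K g) :=
  Measurable.lintegral_prod_right' (f := fun t : X × Z => (g t.2 : ℝ≥0∞) * K t) (by fun_prop)

theorem measurable_schrodingerPlan_density (hK : Measurable K) (hg : Measurable g) :
    Measurable fun t : X × Z => (g t.2 : ℝ≥0∞) * K t / potential ℓ K g t.1 := by
  have := measurable_potential (ℓ := ℓ) hK hg
  fun_prop

theorem fst_schrodingerPlan [SFinite Q] (hK : Measurable K) (hg : Measurable g) :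
    (schrodingerPlan ℓ Q K g).fst =
      Q.withDensity fun x => potential ℓ K g x / potential ℓ K g x := by
  rw [schrodingerPlan, fst_prod_withDensity _ _ (measurable_schrodingerPlan_density hK hg)]
  congr 1 with x
  simp only [div_eq_mul_inv]
  exact lintegral_mul_const _ (by fun_prop)

theorem snd_schrodingerPlan [SFinite Q] (hK : Measurable K) (hg : Measurable g) :
    (schrodingerPlan ℓ Q K g).snd =
      ℓ.withDensity fun z => (g z : ℝ≥0∞) * ∫⁻ x, K (x, z) / potential ℓ K g x ∂Q := by
  have := measurable_potential (ℓ := ℓ) hK hg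
  rw [schrodingerPlan, snd_prod_withDensity _ _ (measurable_schrodingerPlan_density hK hg)]
  congr 1 with z
  simp only [mul_div_assoc]
  exact lintegral_const_mul _ (by fun_prop)

variable [IsProbabilityMeasure Q]

theorem isSchrodinger_of_prod_withDensity {α : Measure X} [SFinite α] (hK : Measurable K)
    (hK0 : ∀ t, K t ≠ 0) (hg : Measurable g)
    (hfst : ((α.prod (ℓ.withDensity fun z => (g z : ℝ≥0∞))).withDensity K).fst = Q)
    (hsnd : ((α.prod (ℓ.withDensity fun z => (g z : ℝ≥0∞))).withDensity K).snd = N) :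
    IsSchrodinger ℓ Q N K g := by
  have hφ : Measurable (potential ℓ K g) := measurable_potential hK hg
  have hpot (x : X) : ∫⁻ z, K (x, z) ∂(ℓ.withDensity fun z => (g z : ℝ≥0∞)) = potential ℓ K g x :=
    lintegral_withDensity_eq_lintegral_mul _ (by fun_prop) (by fun_prop)
  rw [fst_prod_withDensity _ _ hK] at hfst
  rw [snd_prod_withDensity _ _ hK,
    ← withDensity_mul _ (by fun_prop) hK.lintegral_prod_left'] at hsnd
  simp only [hpot] at hfst
  have hne : (ℓ.withDensity fun z => (g z : ℝ≥0∞)) ≠ 0 := by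
    intro h0
    have : Q = 0 := by simp [← hfst, ← hpot, h0]
    exact IsProbabilityMeasure.ne_zero Q this
  have hφ0 (x : X) : potential ℓ K g x ≠ 0 :=
    hpot x ▸ lintegral_ne_zero_of_forall_ne_zero hne (by fun_prop) fun z => hK0 (x, z)
  have hφtop : ∀ᵐ x ∂α, potential ℓ K g x ≠ ∞ := by
    refine (ae_lt_top hφ ?_).mono fun x hx => hx.ne
    rw [← setLIntegral_univ, ← withDensity_apply _ .univ, hfst]
    exact measure_ne_top Q _
  have hα : α = Q.withDensity (potential ℓ K g)⁻¹ := by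
    rw [← hfst]
    exact (withDensity_inv_same₀ hφ.aemeasurable (.of_forall hφ0) hφtop).symm
  have hinteg (z : Z) : ∫⁻ x, K (x, z) ∂α = ∫⁻ x, K (x, z) / potential ℓ K g x ∂Q := by
    rw [hα, lintegral_withDensity_eq_lintegral_mul _ hφ.inv (by fun_prop)]
    simp only [Pi.mul_apply, Pi.inv_apply, ENNReal.div_eq_inv_mul]
  refine ⟨hg, hsnd.symm.trans ?_⟩
  simp only [← hinteg]
  rfl

variable [IsProbabilityMeasure N]

theorem IsSchrodinger.potential_ae_ne_zero_ne_top (h : IsSchrodinger ℓ Q N K g)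
    (hK : Measurable K) : ∀ᵐ x ∂Q, potential ℓ K g x ≠ 0 ∧ potential ℓ K g x ≠ ∞ := by
  have hmass : ∫⁻ x, potential ℓ K g x / potential ℓ K g x ∂Q = 1 := by
    rw [← setLIntegral_univ, ← withDensity_apply _ .univ, ← fst_schrodingerPlan hK h.1,
      Measure.fst_univ, ← Measure.snd_univ, snd_schrodingerPlan hK h.1, ← h.2, measure_univ]
  have hone : ∀ᵐ x ∂Q, potential ℓ K g x / potential ℓ K g x = 1 :=
    ae_eq_of_ae_le_of_lintegral_le (.of_forall fun x => ENNReal.div_self_le_one)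
      (hmass.trans_ne ENNReal.one_ne_top) aemeasurable_const (by simp [hmass])
  filter_upwards [hone] with x hx
  constructor <;> intro h0 <;> simp [h0] at hx

theorem IsSchrodinger.schrodingerPlan_mem_couplings (h : IsSchrodinger ℓ Q N K g)
    (hK : Measurable K) : schrodingerPlan ℓ Q K g ∈ couplings Q N := by
  have hsnd : (schrodingerPlan ℓ Q K g).snd = N := (snd_schrodingerPlan hK h.1).trans h.2.symm
  refine ⟨⟨by rw [← Measure.snd_univ, hsnd, measure_univ]⟩, ?_, hsnd⟩
  calc (schrodingerPlan ℓ Q K g).fst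
      = Q.withDensity fun x => potential ℓ K g x / potential ℓ K g x :=
        fst_schrodingerPlan hK h.1
    _ = Q.withDensity 1 := withDensity_congr_ae
        ((h.potential_ae_ne_zero_ne_top hK).mono fun x hx => ENNReal.div_self hx.1 hx.2)
    _ = Q := withDensity_one

theorem IsSchrodinger.hasProductDensity (h : IsSchrodinger ℓ Q N K g) (hK : Measurable K) :
    HasProductDensity (schrodingerPlan ℓ Q K g) ((Q.prod ℓ).withDensity K) := by
  have hφ := measurable_potential (ℓ := ℓ) hK h.1
  refine ⟨fun x => (potential ℓ K g x)⁻¹.toNNReal, g, by fun_prop, h.1, ?_⟩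
  rw [schrodingerPlan, ← withDensity_mul _ hK (by have := h.1; fun_prop)]
  have hpot : ∀ᵐ t ∂Q.prod ℓ, potential ℓ K g t.1 ≠ 0 :=
    Measure.quasiMeasurePreserving_fst.ae
      ((h.potential_ae_ne_zero_ne_top hK).mono fun x hx => hx.1)
  refine withDensity_congr_ae (hpot.mono fun t ht => ?_)
  simp only [Pi.mul_apply, ENNReal.coe_mul]
  rw [ENNReal.coe_toNNReal (ENNReal.inv_ne_top.2 ht), div_eq_mul_inv]
  ring

/-- The plan of a solution is determined by its marginals, and its density `g z * K / potential`
with respect to `Q ⊗ ℓ` determines `g` up to the potential. -/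
theorem IsSchrodinger.exists_ae_eq_const_mul (h : IsSchrodinger ℓ Q N K g)
    (h' : IsSchrodinger ℓ Q N K g') (hK : Measurable K) (hK0 : ∀ t, K t ≠ 0)
    (hKtop : ∀ t, K t ≠ ∞) : ∃ c : ℝ≥0, 0 < c ∧ g' =ᵐ[ℓ] fun z => c * g z := by
  obtain ⟨hprob, hfst, hsnd⟩ := h.schrodingerPlan_mem_couplings hK
  obtain ⟨hprob', hfst', hsnd'⟩ := h'.schrodingerPlan_mem_couplings hK
  have hplan : schrodingerPlan ℓ Q K g' = schrodingerPlan ℓ Q K g :=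
    (h.hasProductDensity hK).eq_of_fst_eq_of_snd_eq (h'.hasProductDensity hK)
      (hfst'.trans hfst.symm) (hsnd'.trans hsnd.symm)
  have hdens := (withDensity_eq_iff_of_sigmaFinite
    (measurable_schrodingerPlan_density hK h'.1).aemeasurable
    (measurable_schrodingerPlan_density hK h.1).aemeasurable).1 hplan
  obtain ⟨x, hx, ⟨hφ0, hφtop⟩, hφ0', hφtop'⟩ := ((Measure.ae_ae_of_ae_prod hdens).and
    ((h.potential_ae_ne_zero_ne_top hK).and (h'.potential_ae_ne_zero_ne_top hK))).exists
  lift potential ℓ K g x to ℝ≥0 using hφtop with φ hφ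
  lift potential ℓ K g' x to ℝ≥0 using hφtop' with φ' hφ'
  rw [ENNReal.coe_ne_zero] at hφ0 hφ0'
  refine ⟨φ' / φ, div_pos (pos_iff_ne_zero.2 hφ0') (pos_iff_ne_zero.2 hφ0), hx.mono fun z hz => ?_⟩
  have hKz := hK0 (x, z)
  lift K (x, z) to ℝ≥0 using hKtop _ with q
  norm_cast at hz hKz
  field_simp at hz ⊢
  exact hz

theorem IsSchrodinger.isSchrodinger_iff (h : IsSchrodinger ℓ Q N K g) (hK : Measurable K)
    (hK0 : ∀ t, K t ≠ 0) (hKtop : ∀ t, K t ≠ ∞) :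
    IsSchrodinger ℓ Q N K g' ↔ Measurable g' ∧ ∃ c : ℝ≥0, 0 < c ∧ g' =ᵐ[ℓ] fun z => c * g z :=
  ⟨fun h' => ⟨h'.1, h.exists_ae_eq_const_mul h' hK hK0 hKtop⟩,
    fun ⟨hg', _, hc, heq⟩ => h.of_ae_eq_const_mul hg' hc heq⟩

theorem IsSchrodinger.isUniqueMinimizer (h : IsSchrodinger ℓ Q N K g) (hK : Measurable K)
    [IsFiniteMeasure ((Q.prod ℓ).withDensity K)]
    (hfin : entropyValue Q N ((Q.prod ℓ).withDensity K) < ∞) :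
    IsUniqueMinimizer Q N ((Q.prod ℓ).withDensity K) (schrodingerPlan ℓ Q K g) :=
  (h.hasProductDensity hK).isUniqueMinimizer (h.schrodingerPlan_mem_couplings hK) hfin

theorem exists_isSchrodinger [MetricSpace X] [ProperSpace X] [BorelSpace X] [MetricSpace Z]
    [ProperSpace Z] [BorelSpace Z] (hN : N ≪ ℓ) (hK : Continuous K) (hK0 : ∀ t, K t ≠ 0)
    (hKtop : ∀ t, K t ≠ ∞) : ∃ g, IsSchrodinger ℓ Q N K g := by
  obtain ⟨α, β, hα, hβ, hfst, hsnd⟩ := exists_prod_withDensity_marginals Q N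
    (ENNReal.continuousOn_toReal.comp_continuous hK hKtop)
    fun t => ENNReal.toReal_pos (hK0 t) (hKtop t)
  simp only [Function.comp_apply, ENNReal.ofReal_toReal (hKtop _)] at hfst hsnd
  have hα0 : α ≠ 0 := by
    rintro rfl
    have : Q = 0 := by simp [← hfst]
    exact IsProbabilityMeasure.ne_zero Q this
  have hβℓ : β ≪ ℓ := by
    rw [snd_prod_withDensity _ _ hK.measurable] at hsnd
    refine (withDensity_absolutelyContinuous' hK.measurable.lintegral_prod_left'.aemeasurable
      (.of_forall fun z => ?_)).trans (hsnd ▸ hN)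
    exact lintegral_ne_zero_of_forall_ne_zero hα0 (by fun_prop) fun x => hK0 (x, z)
  have hβg : β = ℓ.withDensity fun z => ((β.rnDeriv ℓ z).toNNReal : ℝ≥0∞) := by
    conv_lhs => rw [← Measure.withDensity_rnDeriv_eq β ℓ hβℓ]
    exact withDensity_congr_ae ((Measure.rnDeriv_lt_top β ℓ).mono fun z hz =>
      (ENNReal.coe_toNNReal hz.ne).symm)
  rw [hβg] at hfst hsnd
  exact ⟨_, isSchrodinger_of_prod_withDensity hK.measurable hK0
    (Measure.measurable_rnDeriv β ℓ).ennreal_toNNReal hfst hsnd⟩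

end Schrodinger

/-! ### Block coordinates -/

section Coordinates

variable {d : ℕ → ℕ} {k i : ℕ}

theorem continuous_join : Continuous fun q : E d i × B d (i + 1) => join q.1 q.2 := by
  refine continuous_pi fun l => Fin.addCases (fun l => ?_) (fun l => ?_) l
  · simp only [join, Fin.append_left]; fun_prop
  · simp only [join, Fin.append_right]; fun_prop

theorem continuous_glue : Continuous fun q : E d i × Tail d k i => glue q.1 q.2 := by
  refine continuous_pi fun l => ?_
  by_cases hl : (l : ℕ) < nn d i
  · simp only [glue, hl, dite_true]; fun_prop
  · simp only [glue, hl, dite_false]; fun_prop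

theorem continuous_trunc {j : ℕ} (h : i ≤ j) : Continuous (trunc (d := d) h) :=
  continuous_pi fun _ => continuous_apply _

theorem trunc_glue (h : i ≤ k) (x : E d i) (w : Tail d k i) : trunc h (glue x w) = x := by
  funext l
  simp only [trunc, glue, Fin.val_castLE, l.isLt, dite_true, Fin.eta]

theorem trunc_glue_succ (h : i + 1 ≤ k) (x : E d (i + 1)) (w : Tail d k (i + 1)) :
    trunc (Nat.le_of_succ_le h) (glue x w) = trunc (Nat.le_succ i) x :=
  congrArg (trunc (Nat.le_succ i)) (trunc_glue h x w)

theorem glue_zero (y : E d 0) (w : Tail d k 0) : glue y w = w := by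
  funext l
  exact dif_neg (Nat.not_lt_zero _)

theorem glue_self (y : E d k) (w : Tail d k k) : glue y w = y := by
  funext l
  exact dif_pos l.isLt

theorem measurePreserving_append (m n : ℕ) :
    MeasurePreserving (fun q : (Fin m → ℝ) × (Fin n → ℝ) => Fin.append q.1 q.2)
      (volume.prod volume) volume := by
  have hsplit := volume_measurePreserving_sumPiEquivProdPi_symm fun _ : Fin m ⊕ Fin n => ℝ
  have hindex := volume_measurePreserving_piCongrLeft (fun _ : Fin (m + n) => ℝ) finSumFinEquiv
  suffices heq : (fun q : (Fin m → ℝ) × (Fin n → ℝ) => Fin.append q.1 q.2) =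
      MeasurableEquiv.piCongrLeft (fun _ => ℝ) finSumFinEquiv ∘
        (MeasurableEquiv.sumPiEquivProdPi fun _ => ℝ).symm from
    heq ▸ hindex.comp hsplit
  funext q l
  obtain ⟨l, rfl⟩ := finSumFinEquiv.surjective l
  rw [Function.comp_apply, MeasurableEquiv.coe_piCongrLeft, Equiv.piCongrLeft_apply_apply]
  rcases l with l | l
  · exact Fin.append_left q.1 q.2 l
  · exact Fin.append_right q.1 q.2 l

theorem measurePreserving_comp_cast {m n : ℕ} (h : m = n) :
    MeasurePreserving (fun v : Fin n → ℝ => v ∘ Fin.cast h) volume volume := by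
  subst h
  exact .id _

theorem nn_sub_nn (h : i + 1 ≤ k) : nn d k - nn d i = d (i + 1) + (nn d k - nn d (i + 1)) := by
  have hle := nn_mono d h
  simp only [nn] at hle ⊢
  omega

/-- The concatenation `ℝ^{d_{i+1}} × ℝ^{n_k - n_{i+1}} → ℝ^{n_k - n_i}`. -/
def tailJoin (h : i + 1 ≤ k) (q : B d (i + 1) × Tail d k (i + 1)) : Tail d k i :=
  Fin.append q.1 q.2 ∘ Fin.cast (nn_sub_nn h)

theorem measurePreserving_tailJoin (h : i + 1 ≤ k) :
    MeasurePreserving (tailJoin (d := d) h) (volume.prod volume) volume :=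
  (measurePreserving_comp_cast (nn_sub_nn h)).comp (measurePreserving_append _ _)

theorem glue_tailJoin (h : i + 1 ≤ k) (y : E d i) (z : B d (i + 1)) (w : Tail d k (i + 1)) :
    glue y (tailJoin h (z, w)) = glue (join y z) w := by
  funext l
  have hnn : nn d (i + 1) = nn d i + d (i + 1) := rfl
  simp only [glue, tailJoin, join, Fin.append, Fin.addCases, Function.comp_apply, Fin.val_cast,
    eq_rec_constant, hnn]
  split_ifs with _ _ hz
  · rfl
  · omega
  · exact (eq_rec_constant (z ⟨l - nn d i, hz⟩) _).symm
  · omega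
  · omega
  · refine congrArg w (Fin.ext ?_)
    exact Nat.sub_sub l (nn d i) (d (i + 1))

theorem lintegral_join_glue (h : i + 1 ≤ k) (y : E d i) {F : E d k → ℝ≥0∞} (hF : Measurable F) :
    ∫⁻ z : B d (i + 1), ∫⁻ w : Tail d k (i + 1), F (glue (join y z) w) =
      ∫⁻ w : Tail d k i, F (glue y w) := by
  have hglue : Measurable fun w : Tail d k i => F (glue y w) :=
    hF.comp (continuous_glue.measurable.comp measurable_prodMk_left)
  have hjoin := measurePreserving_tailJoin (d := d) h
  simp only [← glue_tailJoin h]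
  rw [← hjoin.lintegral_comp hglue]
  exact (lintegral_prod _ (hglue.comp hjoin.measurable).aemeasurable).symm

end Coordinates

/-! ### The conditional densities -/

section Densities

variable {d : ℕ → ℕ} {k i : ℕ} {p : E d k → E d k → ℝ}

theorem pMarg_top (x y : E d k) : pMarg d k p k x y = ENNReal.ofReal (p x y) := by
  have : IsEmpty (Fin (nn d k - nn d k)) := by rw [Nat.sub_self]; infer_instance
  simp only [pMarg, glue_self, lintegral_const, volume_pi, Measure.pi_univ, Finset.univ_eq_empty,
    Finset.prod_empty, mul_one]

theorem DensityAssumption.pMarg_zero (hp : DensityAssumption d k p) (x y : E d 0) :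
    pMarg d k p 0 x y = 1 := by
  simp only [pMarg, glue_zero]
  exact hp.prob _

theorem DensityAssumption.lintegral_glue_congr (hp : DensityAssumption d k p) (hi : i < k)
    {x x' : E d k} (h : trunc hi.le x = trunc hi.le x') (y : E d i) :
    ∫⁻ w : Tail d k i, ENNReal.ofReal (p x (glue y w)) =
      ∫⁻ w : Tail d k i, ENNReal.ofReal (p x' (glue y w)) := by
  rcases i.eq_zero_or_pos with rfl | hi0
  · simp only [glue_zero]
    exact (hp.prob x).trans (hp.prob x').symm
  · exact hp.indep i hi0 hi x x' h y

theorem DensityAssumption.pMarg_ne_zero (hp : DensityAssumption d k p) (x y : E d i) :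
    pMarg d k p i x y ≠ 0 := by
  have hF : Continuous fun w : Tail d k i => p (glue x 0) (glue y w) :=
    hp.cont.comp (continuous_const.prodMk
      (continuous_glue.comp (continuous_const.prodMk continuous_id)))
  exact lintegral_ne_zero_of_forall_ne_zero (NeZero.ne _) hF.measurable.ennreal_ofReal
    fun w => (ENNReal.ofReal_pos.2 (hp.pos _ _)).ne'

theorem DensityAssumption.pMarg_ne_top (hp : DensityAssumption d k p) (hi : i ≤ k)
    (x y : E d i) : pMarg d k p i x y ≠ ∞ := by
  rcases i.eq_zero_or_pos with rfl | hi0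
  · rw [hp.pMarg_zero]
    exact ENNReal.one_ne_top
  rcases hi.eq_or_lt with rfl | hlt
  · rw [pMarg_top]
    exact ENNReal.ofReal_ne_top
  · exact hp.marg_finite i hi0 hlt x y

theorem DensityAssumption.continuous_pMarg (hp : DensityAssumption d k p) (hi : i ≤ k) :
    Continuous (Function.uncurry (pMarg d k p i)) := by
  rcases i.eq_zero_or_pos with rfl | hi0
  · simp only [Function.uncurry_def, hp.pMarg_zero]
    exact continuous_const
  rcases hi.eq_or_lt with rfl | hlt
  · simp only [Function.uncurry_def, pMarg_top]
    exact ENNReal.continuous_ofReal.comp hp.cont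
  · exact hp.marg_cont i hi0 hlt

theorem DensityAssumption.lintegral_pMarg_succ (hp : DensityAssumption d k p) (hi : i + 1 ≤ k)
    (x : E d (i + 1)) (y : E d i) :
    ∫⁻ z : B d (i + 1), pMarg d k p (i + 1) x (join y z) =
      pMarg d k p i (trunc (Nat.le_succ i) x) y := by
  have hF : Measurable fun v : E d k => ENNReal.ofReal (p (glue x 0) v) :=
    (hp.cont.comp (continuous_const.prodMk continuous_id)).measurable.ennreal_ofReal
  simp only [pMarg]
  rw [lintegral_join_glue hi y hF]
  refine hp.lintegral_glue_congr hi ?_ y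
  rw [trunc_glue_succ hi, trunc_glue]

theorem DensityAssumption.pCond_eq_div (hp : DensityAssumption d k p) (hi : i + 1 ≤ k)
    (x : E d (i + 1)) (z : B d (i + 1)) (y : E d i) :
    pCond d k p i x z y =
      pMarg d k p (i + 1) x (join y z) / pMarg d k p i (trunc (Nat.le_succ i) x) y := by
  rw [pCond, hp.lintegral_pMarg_succ hi]

theorem DensityAssumption.continuous_pMarg_join (hp : DensityAssumption d k p) (hi : i + 1 ≤ k)
    (y : E d i) :
    Continuous fun t : E d (i + 1) × B d (i + 1) => pMarg d k p (i + 1) t.1 (join y t.2) :=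
  (hp.continuous_pMarg hi).comp (continuous_fst.prodMk
    (continuous_join.comp (continuous_const.prodMk continuous_snd)))

theorem DensityAssumption.continuous_pCond (hp : DensityAssumption d k p) (hi : i + 1 ≤ k)
    (y : E d i) : Continuous fun t : E d (i + 1) × B d (i + 1) => pCond d k p i t.1 t.2 y := by
  have hden : Continuous fun t : E d (i + 1) × B d (i + 1) =>
      pMarg d k p i (trunc (Nat.le_succ i) t.1) y :=
    (hp.continuous_pMarg (Nat.le_of_succ_le hi)).comp
      (((continuous_trunc (Nat.le_succ i)).comp continuous_fst).prodMk continuous_const)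
  simp only [hp.pCond_eq_div hi]
  exact continuous_iff_continuousAt.2 fun t => ENNReal.Tendsto.div
    (hp.continuous_pMarg_join hi y).continuousAt (.inl (hp.pMarg_ne_zero _ _))
    hden.continuousAt (.inl (hp.pMarg_ne_top (Nat.le_of_succ_le hi) _ _))

theorem DensityAssumption.pCond_ne_zero (hp : DensityAssumption d k p) (hi : i + 1 ≤ k)
    (x : E d (i + 1)) (z : B d (i + 1)) (y : E d i) : pCond d k p i x z y ≠ 0 := by
  rw [hp.pCond_eq_div hi]
  exact ENNReal.div_ne_zero.2 ⟨hp.pMarg_ne_zero _ _, hp.pMarg_ne_top (Nat.le_of_succ_le hi) _ _⟩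

theorem DensityAssumption.pCond_ne_top (hp : DensityAssumption d k p) (hi : i + 1 ≤ k)
    (x : E d (i + 1)) (z : B d (i + 1)) (y : E d i) : pCond d k p i x z y ≠ ∞ := by
  rw [hp.pCond_eq_div hi]
  exact ENNReal.div_ne_top (hp.pMarg_ne_top hi _ _) (hp.pMarg_ne_zero _ _)

theorem DensityAssumption.lintegral_pCond (hp : DensityAssumption d k p) (hi : i + 1 ≤ k)
    (x : E d (i + 1)) (y : E d i) : ∫⁻ z, pCond d k p i x z y = 1 := by
  have hm : Measurable fun z => pMarg d k p (i + 1) x (join y z) :=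
    (hp.continuous_pMarg_join hi y).measurable.comp measurable_prodMk_left
  simp only [hp.pCond_eq_div hi, div_eq_mul_inv]
  rw [lintegral_mul_const _ hm, hp.lintegral_pMarg_succ hi]
  exact ENNReal.mul_inv_cancel (hp.pMarg_ne_zero _ _) (hp.pMarg_ne_top (Nat.le_of_succ_le hi) _ _)

theorem DensityAssumption.isProbabilityMeasure_prod_withDensity_pCond
    (hp : DensityAssumption d k p) (hi : i + 1 ≤ k) (y : E d i) (Q : Measure (E d (i + 1)))
    [IsProbabilityMeasure Q] :
    IsProbabilityMeasure ((Q.prod volume).withDensity fun t => pCond d k p i t.1 t.2 y) := by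
  have hfst := fst_prod_withDensity Q volume (hp.continuous_pCond hi y).measurable
  simp only [hp.lintegral_pCond hi] at hfst
  refine ⟨?_⟩
  rw [← Measure.fst_univ, hfst]
  simp

theorem DensityAssumption.planCond_eq_schrodingerPlan (hp : DensityAssumption d k p)
    (hi : i + 1 ≤ k) (y : E d i) (Q : Measure (E d (i + 1))) (g : B d (i + 1) → ℝ≥0) :
    planCond d k p i y Q g =
      schrodingerPlan volume Q (fun t => pCond d k p i t.1 t.2 y) g := by
  rw [planCond, schrodingerPlan]
  congr 1 with t
  set c := (pMarg d k p i (trunc (Nat.le_succ i) t.1) y)⁻¹ with hc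
  have hc0 : c ≠ 0 := ENNReal.inv_ne_zero.2 (hp.pMarg_ne_top (Nat.le_of_succ_le hi) _ _)
  have hctop : c ≠ ∞ := ENNReal.inv_ne_top.2 (hp.pMarg_ne_zero _ _)
  have hnum (z : B d (i + 1)) : (g z : ℝ≥0∞) * pCond d k p i t.1 z y =
      c * (g z * pMarg d k p (i + 1) t.1 (join y z)) := by
    rw [hp.pCond_eq_div hi, div_eq_mul_inv, ← hc]
    ring
  have hpot : potential volume (fun t => pCond d k p i t.1 t.2 y) g t.1 =
      c * hZero d k p i g t.1 y := by
    simp only [potential, hZero, hnum]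
    exact lintegral_const_mul' _ _ hctop
  rw [hpot, hnum, ENNReal.mul_div_mul_left _ _ hc0 hctop]

theorem isProbabilityMeasure_targetCond {f : E d k → ℝ≥0} (hf : Measurable f) (hi : i + 1 ≤ k)
    {y : E d i} (h0 : fMarg d k f i y ≠ 0) (htop : fMarg d k f i y ≠ ∞) :
    IsProbabilityMeasure (targetCond d k f i y) := by
  refine ⟨?_⟩
  rw [targetCond, withDensity_apply _ .univ, setLIntegral_univ]
  simp only [fCond, div_eq_mul_inv]
  rw [lintegral_mul_const' _ _ (ENNReal.inv_ne_top.2 h0)]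
  simp only [fMarg] at h0 htop ⊢
  rw [lintegral_join_glue hi y hf.coe_nnreal_ennreal]
  exact ENNReal.mul_inv_cancel h0 htop

theorem isProbabilityMeasure_sourceCond {μ : Measure (E d k)} [IsFiniteMeasure μ]
    {f : E d k → ℝ≥0} {h : (j : ℕ) → E d j → ℝ≥0} (hi : i + 1 ≤ k) {y : E d i}
    (hprob : IsProbabilityMeasure (piCond d k p μ f h i (Nat.le_of_succ_le hi) y)) :
    IsProbabilityMeasure (sourceCond d k p μ f h i hi y) := by
  have : IsMarkovKernel (muCond μ i hi) := by unfold muCond; infer_instance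
  rw [sourceCond]
  exact Measure.isProbabilityMeasure_map continuous_join.measurable.aemeasurable

theorem fMarg_ne_top_of_isProbabilityMeasure {μ : Measure (E d k)} {f : E d k → ℝ≥0}
    {h : (j : ℕ) → E d j → ℝ≥0} (hi : i ≤ k) {y : E d i}
    (hprob : IsProbabilityMeasure (piCond d k p μ f h i hi y)) : fMarg d k f i y ≠ ∞ := by
  intro htop
  have hmass := hprob.measure_univ
  simp [piCond, htop] at hmass

end Densities

end

end CondSchrodinger

open CondSchrodinger in
theorem proposition2p1_general {k : ℕ} {d : ℕ → ℕ} {p : E d k → E d k → ℝ} {f : E d k → ℝ≥0}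
    (hp : DensityAssumption d k p) (hf : Measurable f) {i : ℕ} (hi : i + 1 ≤ k) {y : E d i}
    (hy0 : fMarg d k f i y ≠ 0) (hytop : fMarg d k f i y ≠ ∞)
    (Q : Measure (E d (i + 1))) [IsProbabilityMeasure Q] :
    (∃ g, IsSolution d k p f i y Q g ∧
      ∀ g', IsSolution d k p f i y Q g' ↔
        Measurable g' ∧ ∃ c : ℝ≥0, 0 < c ∧ g' =ᵐ[volume] fun z => c * g z) ∧
    ∀ g, IsSolution d k p f i y Q g →
      planCond d k p i y Q g ∈ couplings Q (targetCond d k f i y) ∧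
      (entropyValue Q (targetCond d k f i y)
          ((Q.prod volume).withDensity fun q => pCond d k p i q.1 q.2 y) < ∞ →
        IsUniqueMinimizer Q (targetCond d k f i y)
          ((Q.prod volume).withDensity fun q => pCond d k p i q.1 q.2 y)
          (planCond d k p i y Q g)) := by
  have := isProbabilityMeasure_targetCond hf hi hy0 hytop
  have := hp.isProbabilityMeasure_prod_withDensity_pCond hi y Q
  have hK := hp.continuous_pCond hi y
  have hK0 (t : E d (i + 1) × B d (i + 1)) := hp.pCond_ne_zero hi t.1 t.2 y
  have hKtop (t : E d (i + 1) × B d (i + 1)) := hp.pCond_ne_top hi t.1 t.2 y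
  refine ⟨?_, fun g hg => ?_⟩
  · obtain ⟨g, hg⟩ := exists_isSchrodinger (Q := Q) (N := targetCond d k f i y)
      (withDensity_absolutelyContinuous _ _) hK hK0 hKtop
    exact ⟨g, hg, fun g' => hg.isSchrodinger_iff hK.measurable hK0 hKtop⟩
  · have hg' : IsSchrodinger volume Q (targetCond d k f i y)
        (fun t => pCond d k p i t.1 t.2 y) g := hg
    rw [hp.planCond_eq_schrodingerPlan hi]
    exact ⟨hg'.schrodingerPlan_mem_couplings hK.measurable, hg'.isUniqueMinimizer hK.measurable⟩

open CondSchrodinger in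
/-- With `i ≥ 1`, `i + 1 ≤ k`, this is the step from level `i` to level `i + 1`. -/
theorem proposition2p1 (k : ℕ) (hk : 2 ≤ k) (d : ℕ → ℕ) (hd : ∀ j, 1 ≤ j → j ≤ k → 1 ≤ d j)
    (p : E d k → E d k → ℝ) (μ ν : Measure (E d k)) [IsProbabilityMeasure μ]
    [IsProbabilityMeasure ν] (f : E d k → ℝ≥0)
    (hp : DensityAssumption d k p) (hconv : ConvexityAssumption d k p) (hν : HasDensity ν f)
    (i : ℕ) (hi1 : 1 ≤ i) (hi : i + 1 ≤ k)
    -- the functions `h_1, …, h_i` of the previous levels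
    (h : (j : ℕ) → E d j → ℝ≥0)
    (hsec : ∀ j < i, ∀ y : E d j, Measurable (fun z : B d (j + 1) => h (j + 1) (join y z)))
    (y : E d i) (hy : 0 < fMarg d k f i y)
    (hprob : IsProbabilityMeasure (piCond d k p μ f h i (Nat.le_of_succ_le hi) y)) :
    -- existence, and uniqueness up to a positive factor for the given `y`
    (∃ g, IsSolution d k p f i y (sourceCond d k p μ f h i hi y) g ∧
      ∀ g', IsSolution d k p f i y (sourceCond d k p μ f h i hi y) g' ↔
        Measurable g' ∧ ∃ c : ℝ≥0, 0 < c ∧ g' =ᵐ[volume] fun z => c * g z) ∧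
    ∀ g, IsSolution d k p f i y (sourceCond d k p μ f h i hi y) g →
      -- prescribed marginals
      planCond d k p i y (sourceCond d k p μ f h i hi y) g ∈
        couplings (sourceCond d k p μ f h i hi y) (targetCond d k f i y) ∧
      -- unique minimality for the entropy relative to the conditional law of `π_{0,i+1}` given `y`,
      -- for those `y` at which the regular conditional probabilities have their explicit form
      ((∀ j, 1 ≤ j → j ≤ i → Measurable (h j)) →
        ∀ (κ₁ : Kernel (E d i) (E d (i + 1))) (κ₀ : Kernel (E d i) (E d (i + 1) × B d (i + 1))),
          IsSourceVersion d k p μ h i hi κ₁ → IsPi0Version d k p μ h i hi κ₀ →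
          κ₀ y = ((κ₁ y).prod volume).withDensity (fun q => pCond d k p i q.1 q.2 y) →
          κ₁ y = sourceCond d k p μ f h i hi y →
          entropyValue (sourceCond d k p μ f h i hi y) (targetCond d k f i y) (κ₀ y) < ∞ →
          IsUniqueMinimizer (sourceCond d k p μ f h i hi y) (targetCond d k f i y) (κ₀ y)
            (planCond d k p i y (sourceCond d k p μ f h i hi y) g)) := by
  have := isProbabilityMeasure_sourceCond hi hprob
  obtain ⟨hsol, hplan⟩ := proposition2p1_general hp hν.1 hi hy.ne'
    (fMarg_ne_top_of_isProbabilityMeasure _ hprob) (sourceCond d k p μ f h i hi y)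
  exact ⟨hsol, fun g hg => (hplan g hg).imp_right fun hmin _ κ₁ κ₀ _ _ hκ₀ hκ₁ => by
    rw [hκ₀, hκ₁]
    exact hmin⟩
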